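/- Let $H_0,H_1$ be complex Hilbert spaces, $X$ a real Banach space and $\mathcal X\subseteq X$ open. For every $\chi\in\mathcal X$ let $\langle\cdot,\cdot\rangle_{0,\chi}$ and $\langle\cdot,\cdot\rangle_{1,\chi}$ be scalar products on $H_0$ and $H_1$ (linear in the first variable) whose norms are equivalent to the given norms of $H_0$ and $H_1$, and let $A_\chi : V\subseteq H_0\to H_1$ be a closed, densely defined linear operator whose domain $V$ does not depend on $\chi$. Assume that the graph norms of the operators $A_\chi$ on $V$ are pairwise equivalent; fix one of them as the norm of $V$, and let $V'_\sharp$ be the space of continuous antilinear maps $V\to\mathbb C$. Assume that for every $\chi$ the space $V\cap \ker(A_\chi)^{\perp}$ (orthogonal complement with respect to $\langle\cdot,\cdot\rangle_{0,\chi}$), with the graph norm, is compactly embedded in $H_0$. Let $T_\chi=A_\chi^*A_\chi$, where the adjoint is taken with respect to the scalar products $\langle\cdot,\cdot\rangle_{0,\chi}$ and $\langle\cdot,\cdot\rangle_{1,\chi}$, and let $0<\lambda_{\chi,1}\le\lambda_{\chi,2}\le\cdots$ be the positive eigenvalues of $T_\chi$, repeated according to multiplicity (put $\lambda_{\chi,j}=0$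 if $T_\chi$ has fewer than $j$ positive eigenvalues). Let $r\in\{1,2,\dots\}\cup\{\infty,\omega\}$ ($\omega$ meaning real analytic) and assume that the maps $\chi\mapsto\mathcal T_\chi\in\mathcal L(V,V'_\sharp)$, $\langle\mathcal T_\chi u,v\rangle=\langle A_\chi u,A_\chi v\rangle_{1,\chi}$, and $\chi\mapsto\mathcal J_\chi\in\mathcal L(H_0,V'_\sharp)$, $\langle\mathcal J_\chi u,v\rangle=\langle u,v\rangle_{0,\chi}$, are of class $C^r$ on $\mathcal X$ (with respect to the real structures). Let $\bar\chi\in\mathcal X$, and let $\bar\lambda>0$ be an eigenvalue of $T_{\bar\chi}$ of multiplicity $m\geq 1$, with $\bar\lambda=\lambda_{\bar\chi,k}=\dots=\lambda_{\bar\chi,k+m-1}$ for some $k\ge1$. Assume that no positive eigenvalue branches off from $0$ at $\bar\chi$: there are $\varepsilon>0$ and a neighbourhood of $\bar\chi$ such that for all $\chi$ in this neighbourhood $T_\chi$ has no eigenvalue in $(0,\varepsilon)$. (This holds, for example, if $\ker A_\chi$ does not depend on $\chi$.) Put $F=\{k,\dots,k+m-1\}$ and, for $s=1,\dots,m$, $$\Lambda_{F,s}[\chi]=\sum_{\substack{j_1,\dots,j_s\in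 F\\ j_1<\dots<j_s}}\lambda_{\chi,j_1}\cdots\lambda_{\chi,j_s}.$$ Then there is an open neighbourhood $\mathcal X_{\bar\chi}\subseteq\mathcal X$ of $\bar\chi$ on which the functions $\Lambda_{F,s}$ are of class $C^r$ for all $s=1,\dots,m$. Moreover, for every orthonormal basis $u_1,\dots,u_m$, with respect to $\langle\cdot,\cdot\rangle_{0,\bar\chi}$, of the eigenspace of $T_{\bar\chi}$ for $\bar\lambda$, for every direction $\dot\chi\in X$ and every $s=1,\dots,m$, the following directional derivatives at $\bar\chi$ in the direction $\dot\chi$ exist and satisfy $$\partial_{\dot\chi}\Lambda_{F,s}[\chi]_{|\chi=\bar\chi}=\bar\lambda^{\,s-1}\binom{m-1}{s-1}\sum_{h=1}^m\Big(\partial_{\dot\chi}\langle A_\chi u_h,A_\chi u_h\rangle_{1,\chi}{}_{|\chi=\bar\chi}-\bar\lambda\,\partial_{\dot\chi}\langle u_h,u_h\rangle_{0,\chi}{}_{|\chi=\bar\chi}\Big).$$ (For $m=s=1$ this is a Hellmann–Feynman formula for a simple eigenvalue.) -/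

import Mathlib

noncomputable section

/-- A scalar product (given as an `InnerProductSpace.Core`) in the convention: linear in the first
variable, antilinear in the second. Mathlib's `inner` has the opposite convention. -/
def scp {H : Type*} [AddCommGroup H] [Module ℂ H] (c : InnerProductSpace.Core ℂ H) (x y : H) : ℂ :=
  c.inner y x

/-- The norm induced by the scalar product `c` is equivalent to the given norm of `H`. -/
def NormEquivalent {H : Type*} [NormedAddCommGroup H] [Module ℂ H]
    (c : InnerProductSpace.Core ℂ H) : Prop :=
  ∃ a b : ℝ, 0 < a ∧ 0 < b ∧
    ∀ x : H, a * ‖x‖ ^ 2 ≤ (scp c x x).re ∧ (scp c x x).re ≤ b * ‖x‖ ^ 2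

section GraphNorm

variable {H0 H1 : Type*} [NormedAddCommGroup H0] [InnerProductSpace ℂ H0]
  [NormedAddCommGroup H1] [InnerProductSpace ℂ H1] {V : Submodule ℂ H0}

/-- The domain `V` of an operator `A : V ⊂ H0 → H1`; as a normed space it carries the graph norm. -/
def GraphDomain (_A : V →ₗ[ℂ] H1) : Type _ := V

instance (A : V →ₗ[ℂ] H1) : AddCommGroup (GraphDomain A) := inferInstanceAs (AddCommGroup V)

instance (A : V →ₗ[ℂ] H1) : Module ℂ (GraphDomain A) := inferInstanceAs (Module ℂ V)

/-- The identity of `V`, with the graph norm on the source. -/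
def GraphDomain.toDomain (A : V →ₗ[ℂ] H1) : GraphDomain A ≃ₗ[ℂ] V := LinearEquiv.refl ℂ V

/-- The map `u ↦ (u, A u)` into the Hilbert space `H0 ⊕ H1`. -/
def GraphDomain.toGraph (A : V →ₗ[ℂ] H1) : GraphDomain A →ₗ[ℂ] WithLp 2 (H0 × H1) :=
  (WithLp.linearEquiv 2 ℂ (H0 × H1)).symm.toLinearMap ∘ₗ
    (V.subtype.prod A) ∘ₗ (GraphDomain.toDomain A).toLinearMap

theorem GraphDomain.toGraph_injective (A : V →ₗ[ℂ] H1) :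
    Function.Injective (GraphDomain.toGraph A) := by
  intro u v h
  have h' := (WithLp.linearEquiv 2 ℂ (H0 × H1)).symm.injective h
  exact (GraphDomain.toDomain A).injective (Subtype.ext (congrArg Prod.fst h'))

/-- The graph norm `(‖u‖² + ‖A u‖²)^(1/2)`. -/
instance (A : V →ₗ[ℂ] H1) : NormedAddCommGroup (GraphDomain A) :=
  NormedAddCommGroup.induced (GraphDomain A) (WithLp 2 (H0 × H1)) (GraphDomain.toGraph A)
    (GraphDomain.toGraph_injective A)

instance (A : V →ₗ[ℂ] H1) : NormedSpace ℂ (GraphDomain A) :=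
  NormedSpace.induced ℂ (GraphDomain A) (WithLp 2 (H0 × H1)) (GraphDomain.toGraph A)

/-- The domain `V ∩ N(A)^⊥` of the reduced operator of `A`, where the orthogonal complement of the
kernel `N(A)` is taken with respect to the scalar product `c` of `H0`. It inherits the graph
norm. -/
def reducedDomain (c : InnerProductSpace.Core ℂ H0) (A : V →ₗ[ℂ] H1) :
    Submodule ℂ (GraphDomain A) where
  carrier := {u | ∀ v : V, A v = 0 → scp c (GraphDomain.toDomain A u : H0) (v : H0) = 0}
  add_mem' := by
    intro a b ha hb v hv
    have h1 := ha v hv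
    have h2 := hb v hv
    unfold scp at h1 h2 ⊢
    rw [map_add, Submodule.coe_add, InnerProductSpace.Core.inner_add_right, h1, h2, add_zero]
  zero_mem' := by
    intro v _
    unfold scp
    rw [map_zero, Submodule.coe_zero, InnerProductSpace.Core.inner_zero_right]
  smul_mem' := by
    intro t a ha v hv
    have h1 := ha v hv
    unfold scp at h1 ⊢
    rw [map_smul, Submodule.coe_smul, InnerProductSpace.Core.inner_smul_right, h1, mul_zero]

/-- The graph of the Hilbert space adjoint `A^*` of `A : V ⊂ H0 → H1`, where `H0`, `H1` carry the
scalar products `c0`, `c1`: the pairs `(y, z)` with `⟨A x, y⟩₁ = ⟨x, z⟩₀` for all `x ∈ V`. -/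
def adjointGraph (c0 : InnerProductSpace.Core ℂ H0) (c1 : InnerProductSpace.Core ℂ H1)
    (A : V →ₗ[ℂ] H1) : Submodule ℂ (H1 × H0) where
  carrier := {p | ∀ x : V, scp c1 (A x) p.1 = scp c0 (x : H0) p.2}
  add_mem' := by
    intro a b ha hb x
    have h1 := ha x
    have h2 := hb x
    unfold scp at h1 h2 ⊢
    rw [Prod.fst_add, Prod.snd_add, InnerProductSpace.Core.inner_add_left,
      InnerProductSpace.Core.inner_add_left, h1, h2]
  zero_mem' := by
    intro x
    unfold scp
    rw [Prod.fst_zero, Prod.snd_zero, InnerProductSpace.Core.inner_zero_left,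
      InnerProductSpace.Core.inner_zero_left]
  smul_mem' := by
    intro t a ha x
    have h1 := ha x
    unfold scp at h1 ⊢
    rw [Prod.smul_fst, Prod.smul_snd, InnerProductSpace.Core.inner_smul_left,
      InnerProductSpace.Core.inner_smul_left, h1]

/-- The eigenspace `{u | A^* A u = μ u}` of the operator `A^* A`; that is, `u ∈ V`,
`A u ∈ D(A^*)` and `A^* (A u) = μ u`. -/
def eigenspaceAdjMul (c0 : InnerProductSpace.Core ℂ H0) (c1 : InnerProductSpace.Core ℂ H1)
    (A : V →ₗ[ℂ] H1) (μ : ℝ) : Submodule ℂ H0 :=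
  ((adjointGraph c0 c1 A).comap (A.prod ((μ : ℂ) • V.subtype))).map V.subtype

end GraphNorm

/-- A family of operators `A χ : V ⊂ H0 → H1` together with families of scalar products `ip0 χ` on
`H0` and `ip1 χ` on `H1`, for `χ` in an open subset `params` of the real Banach space `X`. (Values
at parameters outside `params` are irrelevant.) -/
structure OperatorFamily (X H0 H1 : Type*) [NormedAddCommGroup X] [NormedSpace ℝ X]
    [NormedAddCommGroup H0] [InnerProductSpace ℂ H0]
    [NormedAddCommGroup H1] [InnerProductSpace ℂ H1] where
  /-- the parameter set -/
  params : Set X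
  isOpen_params : IsOpen params
  /-- the scalar product `⟨·,·⟩_{0,χ}` -/
  ip0 : X → InnerProductSpace.Core ℂ H0
  /-- the scalar product `⟨·,·⟩_{1,χ}` -/
  ip1 : X → InnerProductSpace.Core ℂ H1
  equiv0 : ∀ χ ∈ params, NormEquivalent (ip0 χ)
  equiv1 : ∀ χ ∈ params, NormEquivalent (ip1 χ)
  /-- the common domain of the operators -/
  V : Submodule ℂ H0
  dense_V : Dense (V : Set H0)
  /-- the operators -/
  A : X → V →ₗ[ℂ] H1
  isClosed_A : ∀ χ ∈ params, (LinearPMap.mk V (A χ)).IsClosed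
  /-- the graph norms are pairwise equivalent -/
  graphNorm_equiv : ∀ χ ∈ params, ∀ χ' ∈ params, ∃ C : ℝ, ∀ u : V,
    ‖(GraphDomain.toDomain (A χ)).symm u‖ ≤ C * ‖(GraphDomain.toDomain (A χ')).symm u‖
  /-- the domain of the reduced operator is compactly embedded in `H0` -/
  compact_embedding : ∀ χ ∈ params,
    IsCompactOperator (fun u : reducedDomain (ip0 χ) (A χ) =>
      (GraphDomain.toDomain (A χ) (u : GraphDomain (A χ)) : H0))
  /-- the parameter whose graph norm is the fixed norm of `V` -/
  ref : X
  ref_mem : ref ∈ params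

namespace OperatorFamily

variable {X H0 H1 : Type*} [NormedAddCommGroup X] [NormedSpace ℝ X]
  [NormedAddCommGroup H0] [InnerProductSpace ℂ H0]
  [NormedAddCommGroup H1] [InnerProductSpace ℂ H1] (F : OperatorFamily X H0 H1)

/-- The space `V` with its fixed graph norm. -/
abbrev VSpace : Type _ := GraphDomain (F.A F.ref)

/-- The space of antilinear continuous maps from `V` to `ℂ`. -/
abbrev VAntidual : Type _ := F.VSpace →L⋆[ℂ] ℂ

/-- The family is of class `C^r` on `params` (as maps between real Banach spaces): the forms
`𝒯_χ : V → V'_♯`, `⟨𝒯_χ u, v⟩ = ⟨A_χ u, A_χ v⟩_{1,χ}`, and `𝒥_χ : H0 → V'_♯`,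
`⟨𝒥_χ u, v⟩ = ⟨u, v⟩_{0,χ}`, depend `C^r` on `χ` in the operator norms. Here `r` is a natural
number, `∞`, or `ω` (real analytic). -/
def IsOfClass (r : WithTop ℕ∞) : Prop :=
  ∃ (𝒯 : X → F.VSpace →L[ℂ] F.VAntidual) (𝒥 : X → H0 →L[ℂ] F.VAntidual),
    (∀ χ ∈ F.params, ∀ u v : F.V,
      𝒯 χ ((GraphDomain.toDomain (F.A F.ref)).symm u) ((GraphDomain.toDomain (F.A F.ref)).symm v)
        = scp (F.ip1 χ) (F.A χ u) (F.A χ v)) ∧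
    (∀ χ ∈ F.params, ∀ (u : H0) (v : F.V),
      𝒥 χ u ((GraphDomain.toDomain (F.A F.ref)).symm v) = scp (F.ip0 χ) u (v : H0)) ∧
    ContDiffOn ℝ r 𝒯 F.params ∧ ContDiffOn ℝ r 𝒥 F.params

/-- The eigenspace of `T_χ = A_χ^* A_χ` for `μ`. -/
def eigenspace (χ : X) (μ : ℝ) : Submodule ℂ H0 :=
  eigenspaceAdjMul (F.ip0 χ) (F.ip1 χ) (F.A χ) μ

/-- The `j`-th positive eigenvalue `λ_{χ,j}` (`j = 1, 2, …`) of `T_χ`, in nondecreasing order and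
repeated according to multiplicity: the least `t > 0` such that the eigenvectors with eigenvalue in
`(0, t]` span a space of dimension at least `j`. -/
def eigenvalue (χ : X) (j : ℕ) : ℝ :=
  sInf {t : ℝ | 0 < t ∧ (j : Cardinal) ≤ Module.rank ℂ ↥(⨆ μ ∈ Set.Ioc 0 t, F.eigenspace χ μ)}

/-- The elementary symmetric function of degree `s` of the eigenvalues `λ_{χ,j}`, `j ∈ I`. -/
def symmFun (I : Finset ℕ) (s : ℕ) (χ : X) : ℝ :=
  ∑ S ∈ I.powersetCard s, ∏ j ∈ S, F.eigenvalue χ j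

/-- The real number `⟨A_χ u, A_χ u⟩_{1,χ}`. -/
def energy (u : F.V) (χ : X) : ℝ := (scp (F.ip1 χ) (F.A χ u) (F.A χ u)).re

/-- The real number `⟨u, u⟩_{0,χ}`. -/
def mass (u : F.V) (χ : X) : ℝ := (scp (F.ip0 χ) (u : H0) (u : H0)).re

end OperatorFamily

end

/-!
The scalar products and operators of the family are first moved to one fixed Hilbert space, the
domain `V` with its fixed graph norm. By the Riesz isomorphism the forms `⟨A u, A v⟩₁` and `⟨u, v⟩₀`
are represented there by bounded symmetric operators `T χ` and `J χ` of class `C^r` in `χ`, and the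
eigenvalue equation `A^* A u = μ u` becomes `T u = μ J u`, an equation for the operator pencil
`T - μ J` (`OperatorFamily.IsOfClass.exists_pencil`, `OperatorFamily.IsRepresentedBy.eigenvalue_eq`).

The kernel of `A` may be infinite-dimensional, so `J` need not be compact. However, `T + J` is
coercive, and `J` is compact on the `J`-orthogonal complement of `ker T`; hence, for `μ > 0`,
`T - μ J` is a compact perturbation of an invertible operator, and it becomes invertible once its
kernel `W` is removed by subtracting `J P`, where `P` is the projection onto `W`
(`isUnit_borderedPencil`). This invertibility is what the implicit function theorem needs to
continue `W` analytically: for all operator pairs `(T, J)` near the given one it yields a frame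
`U : W → V` and an endomorphism `M` of `W` with `T U = J U M`, and all eigenvectors for eigenvalues
near `μ` lie in the range of `U` (`exists_analytic_branch`). For symmetric pencils `M` is
diagonalizable with real eigenvalues, and these are the eigenvalues of the pencil near `μ`
(`exists_analytic_eigenvalue_group`).

It remains to identify the labels of these eigenvalues. The number of eigenvalues in `(0, t]` is
locally constant in the parameter for small `t`, because no eigenvalue branches off from `0`. By the
previous step applied at each `μ ≤ lam`, this property can be propagated along the connected
interval up to `lam` (`eventually_isCountLocallyConstant`), so that the eigenvalues of `M` carry
exactly the labels `k, …, k + m - 1` (`exists_analytic_labelled_group`).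

The symmetric functions are then, up to sign, coefficients of the characteristic polynomial of `M`,
hence of class `C^r`. At `χ₀` the single eigenvalues are only Lipschitz in the parameter, but
expanding the products around the common value `lam` up to quadratic errors shows that the
derivative of each symmetric function is a multiple of the derivative of the trace of `M`
(`hasDerivAt_sum_prod_powersetCard`). The latter is obtained by differentiating `T U = J U M` and
pairing with the eigenvectors: the derivative of `U` cancels by symmetry
(`hasDerivAt_trace_of_frame`).
-/

/-! ### The Fredholm alternative for the pencil -/

section Pencil

variable {E : Type*} [NormedAddCommGroup E] [InnerProductSpace ℂ E]

/-- The eigenspace `{u | T u = ν J u}` of the operator pencil `T - ν J`. -/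
def pencilEigenspace (T J : E →L[ℂ] E) (ν : ℝ) : Submodule ℂ E :=
  LinearMap.ker ((T - (ν : ℂ) • J : E →L[ℂ] E) : E →ₗ[ℂ] E)

theorem mem_pencilEigenspace {T J : E →L[ℂ] E} {ν : ℝ} {u : E} :
    u ∈ pencilEigenspace T J ν ↔ T u = (ν : ℂ) • J u := by
  simp [pencilEigenspace, sub_eq_zero]

/-- The operator `T - μ J - J P`, where `P` is the orthogonal projection onto `W`. If `W` is the
kernel of `T - μ J`, the last term removes this kernel. -/
noncomputable def borderedPencil (T J : E →L[ℂ] E) (μ : ℂ) (W : Submodule ℂ E)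
    [W.HasOrthogonalProjection] : E →L[ℂ] E :=
  T - μ • J - J ∘L W.subtypeL ∘L W.orthogonalProjectionOnto

theorem isUnit_of_injective_of_isUnit_add_isCompactOperator [CompleteSpace E]
    {G C : E →L[ℂ] E} (hG : IsUnit G) (hC : IsCompactOperator C)
    (hinj : ∀ u, (G - C) u = 0 → u = 0) : IsUnit (G - C) := by
  obtain ⟨g, rfl⟩ := hG
  have hcomp : IsCompactOperator ((↑g⁻¹ : E →L[ℂ] E) * C) := hC.clm_comp (↑g⁻¹ : E →L[ℂ] E)
  have hfac : (↑g : E →L[ℂ] E) - C = ↑g * (1 - ↑g⁻¹ * C) := by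
    rw [mul_sub, mul_one, Units.mul_inv_cancel_left]
  rcases hcomp.hasEigenvalue_or_mem_resolventSet (one_ne_zero (α := ℂ)) with h | h
  · obtain ⟨x, hx⟩ := h.exists_hasEigenvector
    refine absurd (hinj x ?_) hx.2
    have hx1 : (↑g⁻¹ * C : E →L[ℂ] E) x = x := by simpa using hx.apply_eq_smul
    rw [hfac, mul_apply_eq_comp, sub_apply, hx1]
    simp
  · rw [spectrum.mem_resolventSet_iff, map_one] at h
    rw [hfac]
    exact g.isUnit.mul h

variable [CompleteSpace E]

/-- If `T + J` is coercive and `J` is compact on the `J`-orthogonal complement of `ker T`, then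
`T - μ J` is, for `μ > 0`, a compact perturbation of an invertible operator: with the projection `Π`
onto `ker T` along its `J`-orthogonal complement, that operator is `(T + J) (1 - (1 + μ) Π)`. -/
theorem isUnit_borderedPencil {T J : E →L[ℂ] E}
    (hT : (T : E →ₗ[ℂ] E).IsSymmetric) (hJ : (J : E →ₗ[ℂ] E).IsSymmetric)
    (hJpos : ∀ u, u ≠ 0 → inner ℂ u (J u) ≠ 0)
    {c : ℝ} (hc : 0 < c) (hcoer : ∀ u, c * ‖u‖ ^ 2 ≤ (inner ℂ u ((T + J) u)).re)
    (N : Submodule ℂ E) (hN : ∀ u, u ∈ N ↔ ∀ k, T k = 0 → inner ℂ k (J u) = 0)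
    (hcomp : IsCompactOperator (fun u : N => J u))
    {μ : ℝ} (hμ : 0 < μ) (W : Submodule ℂ E) [FiniteDimensional ℂ W]
    (hW : W = pencilEigenspace T J μ) : IsUnit (borderedPencil T J μ W) := by
  set K : Submodule ℂ E := LinearMap.ker (T : E →ₗ[ℂ] E) with hK
  have memK : ∀ k, k ∈ K ↔ T k = 0 := fun k => by simp [hK]
  have : CompleteSpace K := (T.isClosed_ker).completeSpace_coe
  have coerNorm : ∀ u, ‖u‖ ^ 2 * ((⟨c, hc.le⟩ : NNReal) : ℝ) ≤ ‖inner ℂ ((T + J) u) u‖ := by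
    intro u
    rw [norm_inner_symm]
    calc _ = c * ‖u‖ ^ 2 := by simp [mul_comm]
      _ ≤ _ := (hcoer u).trans (Complex.re_le_norm _)
  have hB : IsUnit (T + J) :=
    ContinuousLinearMap.isUnit_of_forall_le_norm_inner_map _ (c := ⟨c, hc.le⟩) hc coerNorm
  -- the compression of `J` to `K` is coercive, since `T` vanishes on `K`
  have hJK : IsUnit (K.orthogonalProjectionOnto ∘L J ∘L K.subtypeL) := by
    refine ContinuousLinearMap.isUnit_of_forall_le_norm_inner_map _ (c := ⟨c, hc.le⟩) hc ?_
    intro x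
    have h := coerNorm (x : E)
    rw [add_apply, (memK x).1 x.2, zero_add] at h
    rwa [← K.inner_orthogonalProjectionOnto_eq_of_mem_right x (J x)] at h
  obtain ⟨jK, hjK⟩ := hJK
  set Q : E →L[ℂ] E :=
    K.subtypeL ∘L (↑jK⁻¹ : K →L[ℂ] K) ∘L K.orthogonalProjectionOnto ∘L J with hQ
  have hQmem : ∀ u, Q u ∈ K := fun u => by simp [hQ]
  have hTQ : ∀ u, T (Q u) = 0 := fun u => (memK _).1 (hQmem u)
  have hQK : ∀ k, k ∈ K → Q k = k := by
    intro k hk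
    have h1 : (↑jK⁻¹ * ↑jK : K →L[ℂ] K) ⟨k, hk⟩ = ⟨k, hk⟩ := by simp
    rw [hjK] at h1
    exact congrArg Subtype.val h1
  have hQN : ∀ u, u - Q u ∈ N := by
    intro u
    rw [hN]
    intro k hk
    have h1 : K.orthogonalProjectionOnto (J (Q u)) = K.orthogonalProjectionOnto (J u) := by
      have : (↑jK * ↑jK⁻¹ : K →L[ℂ] K) (K.orthogonalProjectionOnto (J u))
          = K.orthogonalProjectionOnto (J u) := by simp
      rw [hjK] at this
      exact this
    have h2 := K.inner_orthogonalProjectionOnto_eq_of_mem_left ⟨k, (memK k).2 hk⟩ (J (u - Q u))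
    rw [map_sub, map_sub, h1, sub_self, inner_zero_right] at h2
    rw [map_sub]
    exact h2.symm
  have hμ1 : (μ : ℂ) ≠ 0 := by exact_mod_cast hμ.ne'
  have hinvQ : IsUnit (1 - ((1 + μ : ℝ) : ℂ) • Q) := by
    have hQQ : Q * Q = Q := by
      ext u
      exact hQK _ (hQmem u)
    have key : ∀ a b : ℂ, a + b = a * b → (1 - a • Q) * (1 - b • Q) = 1 := by
      intro a b hab
      have : (1 - a • Q) * (1 - b • Q) = 1 - (a + b) • Q + (a * b) • (Q * Q) := by
        simp only [sub_mul, mul_sub, one_mul, mul_one, smul_mul_assoc, mul_smul_comm]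
        module
      rw [this, hQQ, hab]
      abel
    refine isUnit_iff_exists.2 ⟨1 - (((1 + μ : ℝ) : ℂ) / μ) • Q, ?_, ?_⟩
    · apply key
      push_cast
      field_simp
      ring
    · apply key
      push_cast
      field_simp
  have hG : IsUnit ((T + J) * (1 - ((1 + μ : ℝ) : ℂ) • Q)) := hB.mul hinvQ
  have hC : IsCompactOperator (((1 + μ : ℝ) : ℂ) • (J ∘L (1 - Q))
      + J ∘L W.subtypeL ∘L W.orthogonalProjectionOnto : E →L[ℂ] E) := by
    have h1 : IsCompactOperator (J ∘L (1 - Q)) :=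
      hcomp.comp_clm ((1 - Q).codRestrict N hQN)
    have h2 : IsCompactOperator (J ∘L W.subtypeL ∘L W.orthogonalProjectionOnto) :=
      ((isCompactOperator_id_iff_finiteDimensional (𝕜 := ℂ) (E := W)).2 inferInstance
        |>.clm_comp (J ∘L W.subtypeL)).comp_clm W.orthogonalProjectionOnto
    exact (h1.smul (((1 + μ : ℝ) : ℂ))).add h2
  have hfac : borderedPencil T J μ W = (T + J) * (1 - ((1 + μ : ℝ) : ℂ) • Q) -
      (((1 + μ : ℝ) : ℂ) • (J ∘L (1 - Q)) + J ∘L W.subtypeL ∘L W.orthogonalProjectionOnto) := by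
    ext u
    simp only [borderedPencil, sub_apply, add_apply,
      smul_apply, mul_apply_eq_comp, map_sub, map_smul, hTQ,
      one_apply_eq_self, ContinuousLinearMap.comp_apply]
    push_cast
    module
  rw [hfac]
  refine isUnit_of_injective_of_isUnit_add_isCompactOperator hG hC ?_
  rw [← hfac]
  intro u hu
  set w : W := W.orthogonalProjectionOnto u with hw
  have hu' : T u - (μ : ℂ) • J u - J w = 0 := by
    exact hu
  -- pairing with the eigenvector `w` kills `T u - μ J u`, hence `w = 0`
  have hWmem : ∀ x, x ∈ W ↔ T x = (μ : ℂ) • J x := fun x => by rw [hW, mem_pencilEigenspace]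
  have hweig : T w = (μ : ℂ) • J w := (hWmem w).1 w.2
  have h0 : inner ℂ (w : E) (T u - (μ : ℂ) • J u) = 0 := by
    have h1 : inner ℂ (w : E) (T u) = inner ℂ (T w) u := (hT (w : E) u).symm
    have h2 : inner ℂ (w : E) (J u) = inner ℂ (J w) u := (hJ (w : E) u).symm
    rw [inner_sub_right, inner_smul_right, h1, h2, hweig, inner_smul_left]
    simp
  have hw0 : (w : E) = 0 := by
    by_contra hne
    apply hJpos _ hne
    rw [sub_eq_zero.1 hu'] at h0
    exact h0
  have huW : u ∈ W := by
    rw [hWmem]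
    rw [hw0, map_zero, sub_zero, sub_eq_zero] at hu'
    exact hu'
  rw [← hw0, hw, Submodule.coe_orthogonalProjectionOnto_apply]
  exact (W.starProjection_eq_self_iff.2 huW).symm

end Pencil

/-! ### Analytic continuation of an isolated eigenvalue group -/

section Branch

open Filter Topology ContDiff

theorem hasFDerivAt_comp_prodMk_right {A B C : Type*} [NormedAddCommGroup A] [NormedSpace ℂ A]
    [NormedAddCommGroup B] [NormedSpace ℂ B] [NormedAddCommGroup C] [NormedSpace ℂ C]
    {f : A × B → C} {a : A} {b : B} (hf : DifferentiableAt ℂ f (a, b)) :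
    HasFDerivAt (fun y => f (a, y)) (fderiv ℂ f (a, b) ∘L .inr ℂ A B) b :=
  hf.hasFDerivAt.comp b (hasFDerivAt_prodMk_right a b)

variable {E : Type*} [NormedAddCommGroup E] [InnerProductSpace ℂ E] [CompleteSpace E]

/-- Let `μ` be an eigenvalue of the pencil `T₀ - μ J₀` with finite-dimensional eigenspace `W`, such
that the bordered pencil is invertible. Near `(T₀, J₀)` there are a frame `U : W → E` and an
endomorphism `M` of `W`, depending analytically on `(T, J)`, with `T U = J U M`; and every
eigenvector of `(T, J)` whose eigenvalue is close to `μ` lies in the range of `U`.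

The implicit function theorem is applied to the unknown `Y : W → E` in `U = ι + Y - ι P Y` and
`M = μ + P Y`, where `ι` is the inclusion of `W` and `P` the orthogonal projection; this
parametrization builds in the normalization `P U = 1`, and the partial derivative of
`T U - J U M` in `Y` is composition with the bordered pencil. -/
theorem exists_analytic_branch {T₀ J₀ : E →L[ℂ] E} {μ : ℂ} (W : Submodule ℂ E)
    [FiniteDimensional ℂ W] (hW : ∀ w ∈ W, T₀ w = μ • J₀ w)
    (hunit : IsUnit (borderedPencil T₀ J₀ μ W)) :
    ∃ (U : (E →L[ℂ] E) × (E →L[ℂ] E) → W →L[ℂ] E) (M : (E →L[ℂ] E) × (E →L[ℂ] E) → W →L[ℂ] W),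
      U (T₀, J₀) = W.subtypeL ∧ M (T₀, J₀) = μ • ContinuousLinearMap.id ℂ W ∧
      ContDiffAt ℂ ω U (T₀, J₀) ∧ ContDiffAt ℂ ω M (T₀, J₀) ∧
      (∀ᶠ p in 𝓝 (T₀, J₀), (∀ w, W.orthogonalProjectionOnto (U p w) = w) ∧
        ∀ w, p.1 (U p w) = p.2 (U p (M p w))) ∧
      ∃ δ > 0, ∀ᶠ p in 𝓝 (T₀, J₀), ∀ ν : ℂ, ‖ν - μ‖ < δ → ∀ u : E, p.1 u = ν • p.2 u →
        U p (W.orthogonalProjectionOnto u) = u := by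
  set ι : W →L[ℂ] E := W.subtypeL with hι
  set P : E →L[ℂ] W := W.orthogonalProjectionOnto with hP
  have hPι : ∀ w : W, P w = w := fun w => by simp [hP]
  set S : E →L[ℂ] E := borderedPencil T₀ J₀ μ W with hS
  set fr : (W →L[ℂ] E) → (W →L[ℂ] E) := fun Y => ι + Y - ι ∘L P ∘L Y with hfr
  set mt : (W →L[ℂ] E) → (W →L[ℂ] W) := fun Y => μ • ContinuousLinearMap.id ℂ W + P ∘L Y with hmt
  have hfrC : ContDiff ℂ ω fr :=
    (contDiff_const.add contDiff_id).sub
      (contDiff_const.clm_comp (contDiff_const.clm_comp contDiff_id))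
  have hmtC : ContDiff ℂ ω mt := contDiff_const.add (contDiff_const.clm_comp contDiff_id)
  set f : ((E →L[ℂ] E) × (E →L[ℂ] E)) × (W →L[ℂ] E) → (W →L[ℂ] E) :=
    fun q => q.1.1 ∘L fr q.2 - q.1.2 ∘L (fr q.2 ∘L mt q.2) with hf
  have hfC : ContDiff ℂ ω f :=
    (contDiff_fst.fst.clm_comp (hfrC.comp contDiff_snd)).sub
      (contDiff_fst.snd.clm_comp ((hfrC.comp contDiff_snd).clm_comp (hmtC.comp contDiff_snd)))
  set q₀ : ((E →L[ℂ] E) × (E →L[ℂ] E)) × (W →L[ℂ] E) := ((T₀, J₀), 0) with hq₀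
  have hfat : ContDiffAt ℂ ω f q₀ := hfC.contDiffAt
  have hω : (ω : WithTop ℕ∞) ≠ 0 := by simp
  have hf0 : f q₀ = 0 := by
    ext w
    simp [hf, hq₀, hfr, hmt, hW _ w.2, hι]
  have hexp : ∀ Y, f ((T₀, J₀), Y) = S ∘L Y - (J₀ ∘L (Y - ι ∘L P ∘L Y)) ∘L (P ∘L Y) := by
    intro Y
    ext w
    have h1 := hW _ w.2
    have h2 := hW _ (P (Y w)).2
    simp only [hf, hfr, hmt, hS, hι, borderedPencil, sub_apply, add_apply, smul_apply, map_sub,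
      map_add, map_smul, ContinuousLinearMap.comp_apply, Submodule.subtypeL_apply,
      ContinuousLinearMap.id_apply, ← hP, h1, h2]
    module
  have hder : HasFDerivAt (fun Y => f ((T₀, J₀), Y))
      (ContinuousLinearMap.compL ℂ W E E S) (0 : W →L[ℂ] E) := by
    have h1 : HasFDerivAt (fun Y : W →L[ℂ] E => S ∘L Y)
        (ContinuousLinearMap.compL ℂ W E E S) (0 : W →L[ℂ] E) :=
      (ContinuousLinearMap.compL ℂ W E E S).hasFDerivAt
    have hc : DifferentiableAt ℂ (fun Y : W →L[ℂ] E => J₀ ∘L (Y - ι ∘L P ∘L Y)) 0 := by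
      have : ContDiff ℂ ω (fun Y : W →L[ℂ] E => J₀ ∘L (Y - ι ∘L P ∘L Y)) :=
        contDiff_const.clm_comp (contDiff_id.sub
          (contDiff_const.clm_comp (contDiff_const.clm_comp contDiff_id)))
      exact this.differentiable hω _
    have hd : DifferentiableAt ℂ (fun Y : W →L[ℂ] E => P ∘L Y) 0 := by
      have : ContDiff ℂ ω (fun Y : W →L[ℂ] E => P ∘L Y) :=
        contDiff_const.clm_comp contDiff_id
      exact this.differentiable hω _
    -- the quadratic term has derivative zero at `Y = 0`
    have h2 := HasFDerivAt.clm_comp (c := fun Y : W →L[ℂ] E => J₀ ∘L (Y - ι ∘L P ∘L Y))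
      (d := fun Y : W →L[ℂ] E => P ∘L Y) hc.hasFDerivAt hd.hasFDerivAt
    have h3 := h1.sub h2
    refine (h3.congr_fderiv ?_).congr_of_eventuallyEq (Eventually.of_forall hexp)
    ext Y w
    simp
  have hinv : (fderiv ℂ f q₀ ∘L .inr ℂ _ _).IsInvertible := by
    have h1 : HasFDerivAt (fun Y : W →L[ℂ] E => f ((T₀, J₀), Y))
        (fderiv ℂ f q₀ ∘L .inr ℂ _ _) (0 : W →L[ℂ] E) := by
      exact hasFDerivAt_comp_prodMk_right (hfC.differentiable hω _)
    rw [h1.unique hder]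
    obtain ⟨s, hs⟩ := hunit
    have hs' : (s : E →L[ℂ] E) = S := hs
    refine ContinuousLinearMap.IsInvertible.of_inverse
      (g := ContinuousLinearMap.compL ℂ W E E (↑s⁻¹ : E →L[ℂ] E)) ?_ ?_
    · ext Y w
      have : (s * ↑s⁻¹ : E →L[ℂ] E) (Y w) = Y w := by simp
      rw [hs'] at this
      exact this
    · ext Y w
      have : (↑s⁻¹ * s : E →L[ℂ] E) (Y w) = Y w := by simp
      rw [hs'] at this
      exact this
  set ψ := hfat.implicitFunction hω hinv with hψ
  have hψ0 : ψ (T₀, J₀) = 0 := hfat.implicitFunction_apply_self hω hinv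
  have hψC : ContDiffAt ℂ ω ψ (T₀, J₀) := hfat.contDiffAt_implicitFunction hω hinv
  have hψeq : ∀ᶠ p in 𝓝 (T₀, J₀), f (p, ψ p) = 0 := by
    have := hfat.eventually_apply_implicitFunction hω hinv
    rwa [hf0] at this
  have hUC : ContDiffAt ℂ ω (fun p => fr (ψ p)) (T₀, J₀) := hfrC.contDiffAt.comp _ hψC
  have hPfr : ∀ Y w, P (fr Y w) = w := by
    intro Y w
    simp [hfr, hι, hPι]
  refine ⟨fun p => fr (ψ p), fun p => mt (ψ p), ?_, ?_, hUC, hmtC.contDiffAt.comp _ hψC, ?_, ?_⟩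
  · simp [hψ0, hfr]
  · simp [hψ0, hmt]
  · filter_upwards [hψeq] with p hp
    refine ⟨hPfr _, fun w => ?_⟩
    have := congrArg (fun L : W →L[ℂ] E => L w) hp
    simpa [hf, sub_eq_zero] using this
  · -- an operator close to the bordered pencil, injective on `E ≃ ker P × W`
    set R : ((E →L[ℂ] E) × (E →L[ℂ] E)) × ℂ → (E →L[ℂ] E) := fun x =>
      (x.1.1 - x.2 • x.1.2) ∘L (1 - ι ∘L P) - x.1.2 ∘L (fr (ψ x.1) ∘L P) with hR
    have hRC : ContinuousAt R ((T₀, J₀), μ) := by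
      have h1 : ContinuousAt (fun x : ((E →L[ℂ] E) × (E →L[ℂ] E)) × ℂ => fr (ψ x.1))
          ((T₀, J₀), μ) :=
        ContinuousAt.comp (g := fun p => fr (ψ p)) (f := Prod.fst) hUC.continuousAt
          continuousAt_fst
      have h2 : ContinuousAt (fun x : ((E →L[ℂ] E) × (E →L[ℂ] E)) × ℂ => x.1.1 - x.2 • x.1.2)
          ((T₀, J₀), μ) := by fun_prop
      have h3 : ContinuousAt (fun x : ((E →L[ℂ] E) × (E →L[ℂ] E)) × ℂ => x.1.2)
          ((T₀, J₀), μ) := by fun_prop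
      exact (h2.clm_comp continuousAt_const).sub (h3.clm_comp (h1.clm_comp continuousAt_const))
    have hR0 : R ((T₀, J₀), μ) = S := by
      ext u
      have h2 := hW _ (P u).2
      simp only [hR, hψ0, hfr, hS, hι, borderedPencil, sub_apply, add_apply, smul_apply, map_sub,
        map_add, ContinuousLinearMap.comp_apply, Submodule.subtypeL_apply, one_apply_eq_self,
        ← hP, h2, zero_apply, map_zero, ContinuousLinearMap.comp_zero]
      module
    have hRunit : ∀ᶠ x in 𝓝 ((T₀, J₀), μ), IsUnit (R x) := by
      refine hRC.eventually (Units.isOpen.mem_nhds ?_)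
      rw [hR0]
      exact hunit
    rw [nhds_prod_eq, eventually_prod_iff] at hRunit
    obtain ⟨pa, hpa, pb, hpb, hab⟩ := hRunit
    obtain ⟨δ, hδ, hball⟩ := Metric.eventually_nhds_iff.1 hpb
    refine ⟨δ, hδ, ?_⟩
    filter_upwards [hpa, hψeq] with p hp hpeq ν hν u hu
    have hunitR : IsUnit (R (p, ν)) := hab hp (hball (by rwa [dist_eq_norm]))
    have hinjR := ((ContinuousLinearMap.isUnit_iff_bijective).1 hunitR).1
    have hM : ∀ w, p.1 (fr (ψ p) w) = p.2 (fr (ψ p) (mt (ψ p) w)) := by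
      intro w
      have := congrArg (fun L : W →L[ℂ] E => L w) hpeq
      simpa [hf, sub_eq_zero] using this
    set w : W := ν • P u - mt (ψ p) (P u) with hw
    set v : E := u - fr (ψ p) (P u) with hv
    have hPv : P v = 0 := by rw [hv, map_sub, hPfr, sub_self]
    have hy : R (p, ν) (v + w) = 0 := by
      have hPy : P (v + w) = w := by rw [map_add, hPv, hPι, zero_add]
      have h1 : R (p, ν) (v + w) = p.1 v - ν • p.2 v - p.2 (fr (ψ p) w) := by
        simp only [hR, sub_apply, ContinuousLinearMap.comp_apply, one_apply_eq_self, hPy, smul_apply,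
          hι, Submodule.subtypeL_apply, add_sub_cancel_right]
      rw [h1, hv, map_sub, map_sub, hu, hM, hw, map_sub, map_sub, map_smul, map_smul]
      module
    have hvw : v + w = 0 := hinjR (by rw [hy, map_zero])
    have hw0 : w = 0 := by
      have := congrArg P hvw
      rwa [map_add, hPv, hPι, zero_add, map_zero] at this
    rw [hw0, ZeroMemClass.coe_zero, add_zero, hv] at hvw
    exact (sub_eq_zero.1 hvw).symm

end Branch

/-! ### Symmetric pencils and the number of their eigenvalues in an interval -/

section Counting

open Filter Topology ContDiff

theorem exists_basis_eigenvectors {W : Type*} [AddCommGroup W] [Module ℂ W]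
    [FiniteDimensional ℂ W] (c : InnerProductSpace.Core ℂ W) (M : W →ₗ[ℂ] W)
    (hM : ∀ x y, c.inner (M x) y = c.inner x (M y)) {m : ℕ} (hm : Module.finrank ℂ W = m) :
    ∃ ν : Fin m → ℝ, Monotone ν ∧
      ∃ b : Module.Basis (Fin m) ℂ W, ∀ i, M (b i) = (ν i : ℂ) • b i := by
  let _ : NormedAddCommGroup W := c.toNormedAddCommGroup
  let _ : InnerProductSpace ℂ W := InnerProductSpace.ofCore c.toCore
  have hsymm : M.IsSymmetric := hM
  refine ⟨fun i => hsymm.eigenvalues hm i.rev, fun i j hij => ?_,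
    (hsymm.eigenvectorBasis hm).toBasis.reindex Fin.revPerm, fun i => ?_⟩
  · exact hsymm.eigenvalues_antitone hm (Fin.rev_le_rev.2 hij)
  · simp [hsymm.apply_eigenvectorBasis hm i.rev]

variable {E : Type*} [NormedAddCommGroup E] [InnerProductSpace ℂ E]

/-- The operators `T` and `J` are symmetric and `J` is positive definite. -/
structure IsSymmetricPencil (T J : E →L[ℂ] E) : Prop where
  symm_left : ∀ u v, inner ℂ (T u) v = inner ℂ u (T v)
  symm_right : ∀ u v, inner ℂ (J u) v = inner ℂ u (J v)
  pos : ∀ u, u ≠ 0 → 0 < (inner ℂ u (J u)).re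

namespace IsSymmetricPencil

variable {T J : E →L[ℂ] E} (h : IsSymmetricPencil T J)
include h

theorem eq_zero_of_inner_eq_zero {u : E} (hu : inner ℂ u (J u) = 0) : u = 0 := by
  by_contra hne
  have := h.pos u hne
  rw [hu] at this
  simp at this

theorem eq_zero_of_apply_eq_zero {u : E} (hu : J u = 0) : u = 0 :=
  h.eq_zero_of_inner_eq_zero (by rw [hu, inner_zero_right])

theorem inner_eq_zero_of_ne {μ ν : ℝ} (hμν : μ ≠ ν) {u v : E} (hu : u ∈ pencilEigenspace T J μ)
    (hv : v ∈ pencilEigenspace T J ν) : inner ℂ u (J v) = 0 := by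
  rw [mem_pencilEigenspace] at hu hv
  have h1 := h.symm_left u v
  rw [hu, hv, inner_smul_left, inner_smul_right, h.symm_right, Complex.conj_ofReal] at h1
  have h2 : ((μ : ℂ) - ν) * inner ℂ u (J v) = 0 := by rw [sub_mul, h1, sub_self]
  rcases mul_eq_zero.1 h2 with h3 | h3
  · exact absurd (by exact_mod_cast sub_eq_zero.1 h3) hμν
  · exact h3

/-- A frame `U` with `T U = J U M` turns `M` into a symmetric endomorphism for the scalar product
`⟨U x, J U y⟩`. -/
theorem exists_basis_of_frame {W : Type*} [NormedAddCommGroup W] [NormedSpace ℂ W]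
    [FiniteDimensional ℂ W] {U : W →L[ℂ] E} {M : W →L[ℂ] W} (hU : Function.Injective U)
    (hUM : ∀ w, T (U w) = J (U (M w))) {m : ℕ} (hm : Module.finrank ℂ W = m) :
    ∃ ν : Fin m → ℝ, Monotone ν ∧
      ∃ b : Module.Basis (Fin m) ℂ W, ∀ i, M (b i) = (ν i : ℂ) • b i := by
  let c : InnerProductSpace.Core ℂ W :=
    { inner := fun x y => inner ℂ (U x) (J (U y))
      conj_inner_symm := fun x y => by rw [inner_conj_symm, h.symm_right]
      re_inner_nonneg := fun x => by
        by_cases hx : U x = 0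
        · simp [hx]
        · exact (h.pos _ hx).le
      add_left := fun x y z => by rw [map_add, inner_add_left]
      smul_left := fun x y r => by rw [map_smul, inner_smul_left]
      definite := fun x hx =>
        hU ((h.eq_zero_of_inner_eq_zero hx).trans (map_zero U).symm) }
  refine exists_basis_eigenvectors c M (fun x y => ?_) hm
  change inner ℂ (U (M x)) (J (U y)) = inner ℂ (U x) (J (U (M y)))
  rw [← hUM, ← h.symm_right, ← hUM, h.symm_left]

end IsSymmetricPencil

/-- The span of the eigenspaces of the pencil for the eigenvalues in `S`. -/
def pencilSpan (T J : E →L[ℂ] E) (S : Set ℝ) : Submodule ℂ E :=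
  ⨆ ν ∈ S, pencilEigenspace T J ν

theorem pencilSpan_mono {T J : E →L[ℂ] E} {S S' : Set ℝ} (hS : S ⊆ S') :
    pencilSpan T J S ≤ pencilSpan T J S' :=
  biSup_mono hS

theorem rank_pencilSpan_mono {T J : E →L[ℂ] E} {S S' : Set ℝ} (hS : S ⊆ S') :
    Module.rank ℂ (pencilSpan T J S) ≤ Module.rank ℂ (pencilSpan T J S') :=
  Submodule.rank_mono (pencilSpan_mono hS)

theorem pencilEigenspace_le_pencilSpan {T J : E →L[ℂ] E} {S : Set ℝ} {ν : ℝ} (hν : ν ∈ S) :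
    pencilEigenspace T J ν ≤ pencilSpan T J S :=
  le_biSup (pencilEigenspace T J) hν

theorem IsSymmetricPencil.rank_pencilSpan_union {T J : E →L[ℂ] E} (h : IsSymmetricPencil T J)
    {S S' : Set ℝ} (hS : Disjoint S S') :
    Module.rank ℂ (pencilSpan T J (S ∪ S')) =
      Module.rank ℂ (pencilSpan T J S) + Module.rank ℂ (pencilSpan T J S') := by
  have horth : ∀ u ∈ pencilSpan T J S, ∀ v ∈ pencilSpan T J S', inner ℂ u (J v) = 0 := by
    -- the vectors `u` that are `J`-orthogonal to a fixed `v` form a subspace, and conversely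
    have h1 : ∀ μ ∈ S, ∀ u ∈ pencilEigenspace T J μ, ∀ v ∈ pencilSpan T J S',
        inner ℂ u (J v) = 0 := by
      intro μ hμ u hu v hv
      have hle : pencilSpan T J S' ≤
          LinearMap.ker ((innerSL ℂ u ∘L J : E →L[ℂ] ℂ) : E →ₗ[ℂ] ℂ) := by
        refine iSup₂_le fun ν hν w hw => ?_
        have hne : μ ≠ ν := fun he => Set.disjoint_left.1 hS hμ (he ▸ hν)
        simpa using h.inner_eq_zero_of_ne hne hu hw
      simpa using hle hv
    intro u hu v hv
    have hle : pencilSpan T J S ≤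
        LinearMap.ker ((innerSL ℂ (J v) : E →L[ℂ] ℂ) : E →ₗ[ℂ] ℂ) := by
      refine iSup₂_le fun μ hμ w hw => ?_
      have := h1 μ hμ w hw v hv
      rw [inner_eq_zero_symm] at this
      simpa using this
    have := hle hu
    rw [inner_eq_zero_symm]
    simpa using this
  have hinf : pencilSpan T J S ⊓ pencilSpan T J S' = ⊥ := by
    rw [Submodule.eq_bot_iff]
    intro x hx
    exact h.eq_zero_of_inner_eq_zero (horth x hx.1 x hx.2)
  have hsup : pencilSpan T J (S ∪ S') = pencilSpan T J S ⊔ pencilSpan T J S' := iSup_union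
  rw [hsup, ← Submodule.rank_sup_add_rank_inf_eq, hinf, rank_bot, add_zero]

/-- The numbers `ν i` are, in nondecreasing order and with multiplicities, all the eigenvalues of
the pencil in the interval `(a, b)`. -/
def IsEigenvalueList (T J : E →L[ℂ] E) (a b : ℝ) {m : ℕ} (ν : Fin m → ℝ) : Prop :=
  Monotone ν ∧ (∀ i, ν i ∈ Set.Ioo a b) ∧ ∃ e : Fin m → E, LinearIndependent ℂ e ∧
    (∀ i, e i ∈ pencilEigenspace T J (ν i)) ∧
    ∀ μ ∈ Set.Ioo a b, pencilEigenspace T J μ ≤ Submodule.span ℂ (Set.range e)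

theorem IsEigenvalueList.rank_pencilSpan {T J : E →L[ℂ] E} (h : IsSymmetricPencil T J)
    {a b : ℝ} {m : ℕ} {ν : Fin m → ℝ} (hν : IsEigenvalueList T J a b ν) {S : Set ℝ}
    (hS : S ⊆ Set.Ioo a b) :
    Module.rank ℂ (pencilSpan T J S) = (Nat.card {i // ν i ∈ S} : Cardinal) := by
  obtain ⟨-, -, e, hli, heig, hspan⟩ := hν
  have hkey : pencilSpan T J S =
      Submodule.span ℂ (Set.range fun i : {i // ν i ∈ S} => e i) := by
    apply le_antisymm
    · refine iSup₂_le fun μ hμ u hu => ?_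
      obtain ⟨c, rfl⟩ := (Submodule.mem_span_range_iff_exists_fun ℂ).1 (hspan μ (hS hμ) hu)
      rw [mem_pencilEigenspace] at hu
      have h1 : ∑ i, (c i * (ν i - μ)) • e i = 0 := by
        apply h.eq_zero_of_apply_eq_zero
        rw [map_sum, map_sum, Finset.smul_sum, ← sub_eq_zero, ← Finset.sum_sub_distrib] at hu
        rw [map_sum, ← hu]
        refine Finset.sum_congr rfl fun i _ => ?_
        rw [map_smul, map_smul, map_smul, mem_pencilEigenspace.1 (heig i)]
        module
      have h2 := Fintype.linearIndependent_iff.1 hli _ h1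
      refine Submodule.sum_mem _ fun i _ => ?_
      rcases mul_eq_zero.1 (h2 i) with h3 | h3
      · rw [h3, zero_smul]
        exact Submodule.zero_mem _
      · have h4 : ν i = μ := by exact_mod_cast sub_eq_zero.1 h3
        exact Submodule.smul_mem _ _ (Submodule.subset_span ⟨⟨i, h4 ▸ hμ⟩, rfl⟩)
    · rw [Submodule.span_le]
      rintro _ ⟨i, rfl⟩
      exact pencilEigenspace_le_pencilSpan i.2 (heig i)
  have hli' : LinearIndependent ℂ fun i : {i // ν i ∈ S} => e i :=
    hli.comp _ Subtype.val_injective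
  classical
  have hfin := FiniteDimensional.span_of_finite ℂ
    (Set.finite_range fun i : {i // ν i ∈ S} => e i)
  rw [hkey, ← Module.finrank_eq_rank, finrank_span_eq_card hli', Nat.card_eq_fintype_card]

theorem abs_sub_le_of_apply_eq_smul {W : Type*} [NormedAddCommGroup W] [NormedSpace ℂ W]
    {M : W →L[ℂ] W} {μ ν : ℝ} {x : W} (hx : x ≠ 0) (hM : M x = (ν : ℂ) • x) :
    |ν - μ| ≤ ‖M - (μ : ℂ) • ContinuousLinearMap.id ℂ W‖ := by
  have h1 : (M - (μ : ℂ) • ContinuousLinearMap.id ℂ W) x = ((ν - μ : ℝ) : ℂ) • x := by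
    simp [hM, sub_smul]
  have h2 := (M - (μ : ℂ) • ContinuousLinearMap.id ℂ W).le_opNorm x
  rw [h1, norm_smul, Complex.norm_real, Real.norm_eq_abs] at h2
  exact le_of_mul_le_mul_right h2 (norm_pos_iff.2 hx)

variable [CompleteSpace E]

/-- The eigenvalues of a symmetric pencil `(T, J)` near an isolated eigenvalue `μ` of `(T₀, J₀)` are
the eigenvalues of an endomorphism `M` of the eigenspace `W` that depends analytically
on `(T, J)`. -/
theorem exists_analytic_eigenvalue_group {T₀ J₀ : E →L[ℂ] E} {μ : ℝ} {m : ℕ}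
    (W : Submodule ℂ E) [FiniteDimensional ℂ W] (hW : W = pencilEigenspace T₀ J₀ μ)
    (hm : Module.finrank ℂ W = m) (hunit : IsUnit (borderedPencil T₀ J₀ μ W)) :
    ∃ (U : (E →L[ℂ] E) × (E →L[ℂ] E) → W →L[ℂ] E) (M : (E →L[ℂ] E) × (E →L[ℂ] E) → W →L[ℂ] W),
      U (T₀, J₀) = W.subtypeL ∧ M (T₀, J₀) = (μ : ℂ) • ContinuousLinearMap.id ℂ W ∧
      ContDiffAt ℂ ω U (T₀, J₀) ∧ ContDiffAt ℂ ω M (T₀, J₀) ∧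
      (∀ᶠ p in 𝓝 (T₀, J₀), ∀ w, p.1 (U p w) = p.2 (U p (M p w))) ∧
      ∃ δ > 0, ∀ᶠ p in 𝓝 (T₀, J₀), IsSymmetricPencil p.1 p.2 →
        ∃ ν : Fin m → ℝ, IsEigenvalueList p.1 p.2 (μ - δ) (μ + δ) ν ∧
          ∃ b : Module.Basis (Fin m) ℂ W, ∀ i, M p (b i) = (ν i : ℂ) • b i := by
  have hWeig : ∀ w ∈ W, T₀ w = (μ : ℂ) • J₀ w := fun w hw => by
    rw [hW] at hw
    exact mem_pencilEigenspace.1 hw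
  obtain ⟨U, M, hU0, hM0, hUC, hMC, hUM, δ, hδ, hspan⟩ := exists_analytic_branch W hWeig hunit
  refine ⟨U, M, hU0, hM0, hUC, hMC, hUM.mono fun p hp => hp.2, δ, hδ, ?_⟩
  have hMnear : ∀ᶠ p in 𝓝 (T₀, J₀), ‖M p - (μ : ℂ) • ContinuousLinearMap.id ℂ W‖ < δ := by
    have h1 : ContinuousAt (fun p => ‖M p - (μ : ℂ) • ContinuousLinearMap.id ℂ W‖) (T₀, J₀) :=
      ContinuousAt.norm (E := W →L[ℂ] W) (hMC.continuousAt.sub continuousAt_const)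
    refine h1.eventually_lt continuousAt_const ?_
    rw [hM0, sub_self]
    exact (ContinuousLinearMap.opNorm_zero).trans_lt hδ
  filter_upwards [hUM, hspan, hMnear] with p hp hpspan hpM hsymm
  have hinj : Function.Injective (U p) := Function.LeftInverse.injective hp.1
  obtain ⟨ν, hmono, b, hb⟩ := hsymm.exists_basis_of_frame hinj hp.2 hm
  refine ⟨ν, ⟨hmono, fun i => ?_, fun i => U p (b i), ?_, fun i => ?_, fun κ hκ u hu => ?_⟩, b, hb⟩
  · have := (abs_sub_le_of_apply_eq_smul (b.ne_zero i) (hb i) (μ := μ)).trans_lt hpM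
    rw [abs_lt] at this
    exact ⟨by linarith, by linarith⟩
  · exact b.linearIndependent.map' (U p : W →ₗ[ℂ] E) (LinearMap.ker_eq_bot.2 hinj)
  · rw [mem_pencilEigenspace, hp.2, hb, map_smul, map_smul]
  · have h1 : U p (W.orthogonalProjectionOnto u) = u := by
      refine hpspan κ ?_ u (mem_pencilEigenspace.1 hu)
      rw [← Complex.ofReal_sub, Complex.norm_real, Real.norm_eq_abs, abs_lt]
      exact ⟨by linarith [hκ.1], by linarith [hκ.2]⟩
    rw [← h1, ← b.sum_repr (W.orthogonalProjectionOnto u), map_sum]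
    refine Submodule.sum_mem _ fun i _ => ?_
    rw [map_smul]
    exact Submodule.smul_mem _ _ (Submodule.subset_span ⟨i, rfl⟩)

end Counting

/-! ### Labelling the eigenvalues of a continuous family of pencils -/

section Labelling

open Filter Topology ContDiff

variable {E : Type*} [NormedAddCommGroup E] [InnerProductSpace ℂ E]

/-- The number of eigenvalues of the pencil in `(0, t]`, with multiplicities. -/
noncomputable def pencilCount (T J : E →L[ℂ] E) (t : ℝ) : Cardinal :=
  Module.rank ℂ (pencilSpan T J (Set.Ioc 0 t))

/-- The `j`-th positive eigenvalue (`j = 1, 2, …`) of the pencil, with multiplicities. -/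
noncomputable def pencilEigenvalue (T J : E →L[ℂ] E) (j : ℕ) : ℝ :=
  sInf {t : ℝ | 0 < t ∧ (j : Cardinal) ≤ pencilCount T J t}

theorem pencilCount_mono {T J : E →L[ℂ] E} : Monotone (pencilCount T J) := fun _ _ hst =>
  rank_pencilSpan_mono (Set.Ioc_subset_Ioc_right hst)

theorem IsSymmetricPencil.pencilCount_add {T J : E →L[ℂ] E} (h : IsSymmetricPencil T J)
    {s t : ℝ} (hs : 0 ≤ s) (hst : s ≤ t) :
    pencilCount T J t = pencilCount T J s + Module.rank ℂ (pencilSpan T J (Set.Ioc s t)) := by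
  rw [pencilCount, ← Set.Ioc_union_Ioc_eq_Ioc hs hst, h.rank_pencilSpan_union, pencilCount]
  exact Set.Ioc_disjoint_Ioc_of_le le_rfl

theorem IsEigenvalueList.pencilCount_eq {T J : E →L[ℂ] E} (h : IsSymmetricPencil T J)
    {a' a b : ℝ} {m n : ℕ} {ν : Fin m → ℝ} (hν : IsEigenvalueList T J a' b ν) (ha : 0 ≤ a)
    (haa' : a' ≤ a) (hn : pencilCount T J a = n) {t : ℝ} (hat : a ≤ t) (htb : t < b) :
    pencilCount T J t = ((n + Nat.card {i // ν i ∈ Set.Ioc a t} : ℕ) : Cardinal) := by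
  rw [h.pencilCount_add ha hat, hn, hν.rank_pencilSpan h]
  · push_cast
    rfl
  · exact fun s hs => ⟨haa'.trans_lt hs.1, hs.2.trans_lt htb⟩

theorem IsEigenvalueList.pencilEigenvalue_eq {T J : E →L[ℂ] E} (h : IsSymmetricPencil T J)
    {a' a b : ℝ} {m n : ℕ} {ν : Fin m → ℝ} (hν : IsEigenvalueList T J a' b ν) (ha : 0 ≤ a)
    (haa' : a' ≤ a) (hn : pencilCount T J a = n) (haν : ∀ i, a < ν i) (i : Fin m) :
    pencilEigenvalue T J (n + i + 1) = ν i := by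
  classical
  have hcount : ∀ t, a ≤ t → t < b → pencilCount T J t =
      ((n + (Finset.univ.filter fun j => ν j ≤ t).card : ℕ) : Cardinal) := by
    intro t hat htb
    rw [hν.pencilCount_eq h ha haa' hn hat htb, Nat.card_eq_fintype_card, Fintype.card_subtype]
    simp [haν]
  have hib : ν i < b := (hν.2.1 i).2
  refine IsLeast.csInf_eq ⟨⟨ha.trans_lt (haν i), ?_⟩, ?_⟩
  · rw [hcount _ (haν i).le hib, Nat.cast_le, add_assoc, Nat.add_le_add_iff_left]
    calc (i : ℕ) + 1 = (Finset.Iic i).card := by simp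
      _ ≤ _ := Finset.card_le_card fun j hj => by
        simpa using hν.1 (Finset.mem_Iic.1 hj)
  · rintro t ⟨-, ht⟩
    by_contra! hlt
    have htb : t < b := hlt.trans hib
    rcases le_or_gt t a with hta | hat
    · have := ht.trans (pencilCount_mono hta)
      rw [hn, Nat.cast_le] at this
      omega
    · rw [hcount t hat.le htb, Nat.cast_le, add_assoc, Nat.add_le_add_iff_left] at ht
      have hcard : (Finset.univ.filter fun j => ν j ≤ t).card ≤ (Finset.Iio i).card := by
        refine Finset.card_le_card fun j hj => ?_
        rw [Finset.mem_Iio]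
        by_contra! hij
        have h1 := hν.1 hij
        have h2 := (Finset.mem_filter.1 hj).2
        linarith
      rw [Fin.card_Iio] at hcard
      omega

variable {X : Type*} [TopologicalSpace X]

/-- The number of eigenvalues in `(0, t]` is finite and the same for all parameters near `χ₀`. -/
def IsCountLocallyConstant (T J : X → E →L[ℂ] E) (χ₀ : X) (t : ℝ) : Prop :=
  ∃ n : ℕ, ∀ᶠ χ in 𝓝 χ₀, pencilCount (T χ) (J χ) t = n

theorem isCountLocallyConstant_iff_of_lt {T J : X → E →L[ℂ] E} {χ₀ : X}
    (hsymm : ∀ᶠ χ in 𝓝 χ₀, IsSymmetricPencil (T χ) (J χ)) {μ δ : ℝ} {m : ℕ} (hδμ : δ ≤ μ)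
    (hlist : ∀ η > 0, ∀ᶠ χ in 𝓝 χ₀, ∃ ν : Fin m → ℝ,
      IsEigenvalueList (T χ) (J χ) (μ - δ) (μ + δ) ν ∧ ∀ i, |ν i - μ| < η)
    {s t : ℝ} (hs : s ∈ Set.Ioo (μ - δ) (μ + δ)) (ht : t ∈ Set.Ioo (μ - δ) (μ + δ))
    (hsμ : s ≠ μ) (htμ : t ≠ μ) (hst : s < t) :
    IsCountLocallyConstant T J χ₀ s ↔ IsCountLocallyConstant T J χ₀ t := by
  have hs0 : 0 ≤ s := by linarith [hs.1]
  obtain ⟨n, hn⟩ : ∃ n : ℕ, ∀ᶠ χ in 𝓝 χ₀,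
      Module.rank ℂ (pencilSpan (T χ) (J χ) (Set.Ioc s t)) = n := by
    refine ⟨Nat.card {_i : Fin m // μ ∈ Set.Ioc s t}, ?_⟩
    have hη : 0 < min |s - μ| |t - μ| :=
      lt_min (abs_pos.2 (sub_ne_zero.2 hsμ)) (abs_pos.2 (sub_ne_zero.2 htμ))
    filter_upwards [hsymm, hlist _ hη] with χ hχ hν
    obtain ⟨ν, hν, hclose⟩ := hν
    rw [hν.rank_pencilSpan hχ fun x hx => ⟨hs.1.trans hx.1, hx.2.trans_lt ht.2⟩]
    -- each `ν i` lies on the same side of `s` and `t` as `μ`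
    have hiff : ∀ i, ν i ∈ Set.Ioc s t ↔ μ ∈ Set.Ioc s t := by
      intro i
      have h1 := (hclose i).trans_le (min_le_left _ _)
      have h2 := (hclose i).trans_le (min_le_right _ _)
      simp only [Set.mem_Ioc]
      grind
    simp only [hiff]
  constructor
  · rintro ⟨N, hN⟩
    refine ⟨N + n, ?_⟩
    filter_upwards [hsymm, hn, hN] with χ hχ h1 h2
    rw [hχ.pencilCount_add hs0 hst.le, h1, h2, Nat.cast_add]
  · rintro ⟨N, hN⟩
    refine ⟨N - n, ?_⟩
    filter_upwards [hsymm, hn, hN] with χ hχ h1 h2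
    rw [hχ.pencilCount_add hs0 hst.le, h1] at h2
    have hlt : pencilCount (T χ) (J χ) s < Cardinal.aleph0 :=
      (self_le_add_right _ _).trans_lt (h2 ▸ Cardinal.natCast_lt_aleph0)
    obtain ⟨j, hj⟩ := Cardinal.lt_aleph0.1 hlt
    rw [hj] at h2 ⊢
    have h3 : j + n = N := by exact_mod_cast h2
    rw [← h3, Nat.add_sub_cancel]

/-- If no eigenvalue emanates from `0`, the number of eigenvalues in `(0, t]` is locally constant in
the parameter for all `t ≠ lam` close to `lam`. Whether this holds for all `t ≠ μ` close to `μ` is a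
locally constant property of `μ`, so that the claim propagates from small `μ` to `lam`. -/
theorem eventually_isCountLocallyConstant {T J : X → E →L[ℂ] E} {χ₀ : X}
    (hsymm : ∀ᶠ χ in 𝓝 χ₀, IsSymmetricPencil (T χ) (J χ)) {lam : ℝ} (hlam : 0 < lam)
    (hlist : ∀ μ ∈ Set.Ioc 0 lam, ∃ m : ℕ, ∃ δ > 0, ∀ η > 0, ∀ᶠ χ in 𝓝 χ₀, ∃ ν : Fin m → ℝ,
      IsEigenvalueList (T χ) (J χ) (μ - δ) (μ + δ) ν ∧ ∀ i, |ν i - μ| < η)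
    {ε : ℝ} (hε : 0 < ε)
    (hgap : ∀ᶠ χ in 𝓝 χ₀, ∀ μ ∈ Set.Ioo 0 ε, pencilEigenspace (T χ) (J χ) μ = ⊥) :
    ∀ᶠ t in 𝓝[≠] lam, IsCountLocallyConstant T J χ₀ t := by
  set good := IsCountLocallyConstant T J χ₀ with hgood
  set ε₁ := min (ε / 2) lam with hε₁
  have hε₁0 : 0 < ε₁ := lt_min (by positivity) hlam
  have hε₁lam : ε₁ ≤ lam := min_le_right _ _
  have hstart : ∀ᶠ t in 𝓝[≠] ε₁, good t := by
    have hlt : ε₁ < ε := (min_le_left _ _).trans_lt (by linarith)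
    filter_upwards [nhdsWithin_le_nhds (eventually_lt_nhds hlt)] with t ht
    refine ⟨0, ?_⟩
    filter_upwards [hgap] with χ hχ
    have : pencilSpan (T χ) (J χ) (Set.Ioc 0 t) = ⊥ := by
      rw [eq_bot_iff]
      exact iSup₂_le fun μ hμ => (hχ μ ⟨hμ.1, hμ.2.trans_lt ht⟩).le
    rw [pencilCount, this, rank_bot, Nat.cast_zero]
  have hlocal : ∀ x ∈ Set.Icc ε₁ lam, ∀ᶠ y in 𝓝[Set.Icc ε₁ lam] x,
      ((∀ᶠ t in 𝓝[≠] x, good t) ↔ ∀ᶠ t in 𝓝[≠] y, good t) := by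
    intro x hx
    have hx0 : 0 < x := hε₁0.trans_le hx.1
    obtain ⟨m, δ₀, hδ₀, hν⟩ := hlist x ⟨hx0, hx.2⟩
    set δ := min δ₀ x with hδ
    have hδpos : 0 < δ := lt_min hδ₀ hx0
    have hsub : ∀ s, s ∈ Set.Ioo (x - δ) (x + δ) → 0 < s ∧ s ∈ Set.Ioo (x - δ₀) (x + δ₀) := by
      intro s hs
      have h1 : δ ≤ δ₀ := min_le_left _ _
      have h2 : δ ≤ x := min_le_right _ _
      exact ⟨by linarith [hs.1], by linarith [hs.1], by linarith [hs.2]⟩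
    have hν' : ∀ η > 0, ∀ᶠ χ in 𝓝 χ₀, ∃ ν : Fin m → ℝ,
        IsEigenvalueList (T χ) (J χ) (x - δ) (x + δ) ν ∧ ∀ i, |ν i - x| < η := by
      intro η hη
      filter_upwards [hν (min η δ) (lt_min hη hδpos)] with χ hχ
      obtain ⟨ν, ⟨hmono, -, e, hli, heig, hspan⟩, hclose⟩ := hχ
      refine ⟨ν, ⟨hmono, fun i => ?_, e, hli, heig, fun κ hκ => hspan κ (hsub κ hκ).2⟩,
        fun i => (hclose i).trans_le (min_le_left _ _)⟩
      have := abs_lt.1 ((hclose i).trans_le (min_le_right _ _))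
      exact ⟨by linarith, by linarith⟩
    have hwin : ∀ s ∈ Set.Ioo (x - δ) (x + δ), s ≠ x → ∀ t ∈ Set.Ioo (x - δ) (x + δ), t ≠ x →
        (good s ↔ good t) := by
      intro s hs hsx t ht htx
      rcases lt_trichotomy s t with h | h | h
      · exact isCountLocallyConstant_iff_of_lt hsymm (min_le_right _ _) hν' hs ht hsx htx h
      · rw [h]
      · exact (isCountLocallyConstant_iff_of_lt hsymm (min_le_right _ _) hν' ht hs htx hsx h).symm
    have hmid : x + δ / 2 ∈ Set.Ioo (x - δ) (x + δ) := ⟨by linarith, by linarith⟩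
    have hmidne : x + δ / 2 ≠ x := by linarith
    have hconst : ∀ z ∈ Set.Ioo (x - δ) (x + δ),
        ((∀ᶠ t in 𝓝[≠] z, good t) ↔ good (x + δ / 2)) := by
      intro z hz
      have hev : ∀ᶠ t in 𝓝[≠] z, t ∈ Set.Ioo (x - δ) (x + δ) ∧ t ≠ x := by
        have hIoo : ∀ᶠ t in 𝓝[≠] z, t ∈ Set.Ioo (x - δ) (x + δ) :=
          nhdsWithin_le_nhds (isOpen_Ioo.mem_nhds hz)
        refine hIoo.and ?_
        rcases eq_or_ne z x with rfl | hzx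
        · exact self_mem_nhdsWithin
        · exact nhdsWithin_le_nhds (isOpen_ne.mem_nhds hzx)
      rw [eventually_congr (hev.mono fun t ht => hwin t ht.1 ht.2 _ hmid hmidne), eventually_const]
    have hyn : ∀ᶠ y in 𝓝[Set.Icc ε₁ lam] x, y ∈ Set.Ioo (x - δ) (x + δ) :=
      nhdsWithin_le_nhds (isOpen_Ioo.mem_nhds ⟨by linarith, by linarith⟩)
    filter_upwards [hyn] with y hy
    rw [hconst x ⟨by linarith, by linarith⟩, hconst y hy]
  exact (isPreconnected_Icc.induction₂
    (fun x y => (∀ᶠ t in 𝓝[≠] x, good t) ↔ ∀ᶠ t in 𝓝[≠] y, good t) hlocal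
    (fun _ _ _ _ _ _ h1 h2 => h1.trans h2) (fun _ _ _ _ h => h.symm)
    (Set.left_mem_Icc.2 hε₁lam) (Set.right_mem_Icc.2 hε₁lam)).1 hstart

variable [CompleteSpace E]

/-- The eigenvalues with the labels of an eigenvalue `lam` of multiplicity `m` at `χ₀` are, near
`χ₀`, the eigenvalues of an endomorphism of the eigenspace that depends analytically on the two
operators of the pencil. -/
theorem exists_analytic_labelled_group {T J : X → E →L[ℂ] E} {χ₀ : X}
    (hT : ContinuousAt T χ₀) (hJ : ContinuousAt J χ₀)
    (hsymm : ∀ᶠ χ in 𝓝 χ₀, IsSymmetricPencil (T χ) (J χ)) {lam : ℝ} (hlam : 0 < lam)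
    (hunit : ∀ μ ∈ Set.Ioc 0 lam,
      ∃ _ : FiniteDimensional ℂ (pencilEigenspace (T χ₀) (J χ₀) μ),
        IsUnit (borderedPencil (T χ₀) (J χ₀) μ (pencilEigenspace (T χ₀) (J χ₀) μ)))
    {ε : ℝ} (hε : 0 < ε)
    (hgap : ∀ᶠ χ in 𝓝 χ₀, ∀ μ ∈ Set.Ioo 0 ε, pencilEigenspace (T χ) (J χ) μ = ⊥)
    {k m : ℕ} (hk : 1 ≤ k) (hm1 : 1 ≤ m)
    (W : Submodule ℂ E) [FiniteDimensional ℂ W] (hW : W = pencilEigenspace (T χ₀) (J χ₀) lam)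
    (hm : Module.finrank ℂ W = m)
    (hindex : ∀ j ∈ Finset.Icc k (k + m - 1), pencilEigenvalue (T χ₀) (J χ₀) j = lam) :
    ∃ (U : (E →L[ℂ] E) × (E →L[ℂ] E) → W →L[ℂ] E) (M : (E →L[ℂ] E) × (E →L[ℂ] E) → W →L[ℂ] W),
      U (T χ₀, J χ₀) = W.subtypeL ∧
      M (T χ₀, J χ₀) = (lam : ℂ) • ContinuousLinearMap.id ℂ W ∧
      ContDiffAt ℂ ω U (T χ₀, J χ₀) ∧ ContDiffAt ℂ ω M (T χ₀, J χ₀) ∧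
      (∀ᶠ p in 𝓝 (T χ₀, J χ₀), ∀ w, p.1 (U p w) = p.2 (U p (M p w))) ∧
      ∀ᶠ χ in 𝓝 χ₀, ∃ b : Module.Basis (Fin m) ℂ W, ∀ i : Fin m,
        M (T χ, J χ) (b i) = (pencilEigenvalue (T χ) (J χ) (k + i) : ℂ) • b i := by
  have hTJ : Tendsto (fun χ => (T χ, J χ)) (𝓝 χ₀) (𝓝 (T χ₀, J χ₀)) :=
    (hT.prodMk hJ).tendsto
  -- eigenvalues of `M` are close to those of its value at `(T χ₀, J χ₀)`
  have hclose : ∀ {μ : ℝ} {d : ℕ} {W' : Submodule ℂ E} [FiniteDimensional ℂ W']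
      {M : (E →L[ℂ] E) × (E →L[ℂ] E) → W' →L[ℂ] W'},
      M (T χ₀, J χ₀) = (μ : ℂ) • ContinuousLinearMap.id ℂ W' →
      ContDiffAt ℂ ω M (T χ₀, J χ₀) → ∀ η > 0, ∀ᶠ χ in 𝓝 χ₀, ∀ (ν : Fin d → ℝ)
        (b : Module.Basis (Fin d) ℂ W'), (∀ i, M (T χ, J χ) (b i) = (ν i : ℂ) • b i) →
          ∀ i, |ν i - μ| < η := by
    intro μ d W' _ M hM0 hMC η hη
    have h1 : ContinuousAt (fun χ => ‖M (T χ, J χ) - (μ : ℂ) • ContinuousLinearMap.id ℂ W'‖) χ₀ :=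
      ContinuousAt.norm (E := W' →L[ℂ] W')
        ((ContinuousAt.comp (g := M) (f := fun χ => (T χ, J χ)) hMC.continuousAt
          (hT.prodMk hJ)).sub continuousAt_const)
    have h2 : ∀ᶠ χ in 𝓝 χ₀, ‖M (T χ, J χ) - (μ : ℂ) • ContinuousLinearMap.id ℂ W'‖ < η := by
      refine h1.eventually_lt continuousAt_const ?_
      rw [hM0, sub_self]
      exact (ContinuousLinearMap.opNorm_zero).trans_lt hη
    filter_upwards [h2] with χ hχ ν b hb i
    exact (abs_sub_le_of_apply_eq_smul (b.ne_zero i) (hb i)).trans_lt hχ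
  have hcount : ∀ᶠ t in 𝓝[≠] lam, IsCountLocallyConstant T J χ₀ t := by
    refine eventually_isCountLocallyConstant hsymm hlam (fun μ hμ => ?_) hε hgap
    obtain ⟨_, hu⟩ := hunit μ hμ
    obtain ⟨U, M, -, hM0, -, hMC, -, δ, hδ, hlist⟩ :=
      exists_analytic_eigenvalue_group _ rfl rfl hu
    refine ⟨Module.finrank ℂ (pencilEigenspace (T χ₀) (J χ₀) μ), δ, hδ, fun η hη => ?_⟩
    filter_upwards [hTJ.eventually hlist, hsymm, hclose hM0 hMC η hη] with χ h1 h2 h3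
    obtain ⟨ν, hν, b, hb⟩ := h1 h2
    exact ⟨ν, hν, h3 ν b hb⟩
  have hu : IsUnit (borderedPencil (T χ₀) (J χ₀) lam W) := by
    subst hW
    obtain ⟨_, hu⟩ := hunit lam ⟨hlam, le_rfl⟩
    exact hu
  obtain ⟨U, M, hU0, hM0, hUC, hMC, hUM, δ, hδ, hlist⟩ :=
    exists_analytic_eigenvalue_group W hW hm hu
  refine ⟨U, M, hU0, hM0, hUC, hMC, hUM, ?_⟩
  -- a level `a` slightly below `lam`, below which the number `n` of eigenvalues does not change
  obtain ⟨a, ⟨n, hn⟩, ha0, haδ, halam⟩ :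
      ∃ a, IsCountLocallyConstant T J χ₀ a ∧ 0 ≤ a ∧ lam - δ ≤ a ∧ a < lam := by
    have h1 : ∀ᶠ t in 𝓝[<] lam, IsCountLocallyConstant T J χ₀ t :=
      hcount.filter_mono (nhdsWithin_mono _ fun t ht => ne_of_lt ht)
    have h2 : ∀ᶠ t in 𝓝[<] lam, max 0 (lam - δ) < t :=
      nhdsWithin_le_nhds (eventually_gt_nhds (max_lt hlam (by linarith)))
    obtain ⟨a, ⟨h3, h4⟩, h5⟩ := ((h1.and h2).and self_mem_nhdsWithin).exists
    exact ⟨a, h3, (le_max_left _ _).trans h4.le, (le_max_right _ _).trans h4.le, h5⟩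
  have hall : ∀ᶠ χ in 𝓝 χ₀, ∃ b : Module.Basis (Fin m) ℂ W, ∀ i : Fin m,
      M (T χ, J χ) (b i) = (pencilEigenvalue (T χ) (J χ) (n + i + 1) : ℂ) • b i := by
    filter_upwards [hTJ.eventually hlist, hsymm, hclose hM0 hMC (lam - a) (by linarith), hn]
      with χ h1 h2 h3 h4
    obtain ⟨ν, hν, b, hb⟩ := h1 h2
    refine ⟨b, fun i => ?_⟩
    rw [hν.pencilEigenvalue_eq h2 ha0 haδ h4 (fun j => ?_), hb]
    linarith [(abs_lt.1 (h3 ν b hb j)).1]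
  -- the labels at `χ₀` identify `n` as `k - 1`
  have hkn : k = n + 1 := by
    have hs₀ := hsymm.self_of_nhds
    have hn₀ : pencilCount (T χ₀) (J χ₀) a = n := hn.self_of_nhds
    obtain ⟨ν, hν, b, hb⟩ := (mem_of_mem_nhds hlist) hs₀
    have hge : n < k := by
      by_contra! hkn
      have h1 := hindex k (Finset.mem_Icc.2 ⟨le_rfl, by omega⟩)
      have hapos : 0 < a ∨ a = 0 := ha0.lt_or_eq.imp_right Eq.symm
      rcases hapos with hapos | rfl
      · have h2 : pencilEigenvalue (T χ₀) (J χ₀) k ≤ a :=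
          csInf_le ⟨0, fun t ht => ht.1.le⟩ ⟨hapos, by rw [hn₀]; exact_mod_cast hkn⟩
        linarith
      · have h2 : pencilSpan (T χ₀) (J χ₀) (Set.Ioc 0 0) = ⊥ := by simp [pencilSpan]
        rw [pencilCount, h2, rank_bot] at hn₀
        have : n = 0 := by exact_mod_cast hn₀.symm
        omega
    have hle : k + m - 1 ≤ n + m := by
      have h1 := hindex (k + m - 1) (Finset.mem_Icc.2 ⟨by omega, le_rfl⟩)
      have hne : {t : ℝ | 0 < t ∧ ((k + m - 1 : ℕ) : Cardinal) ≤ pencilCount (T χ₀) (J χ₀) t}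
          |>.Nonempty := by
        by_contra hem
        rw [Set.not_nonempty_iff_eq_empty] at hem
        rw [pencilEigenvalue, hem, Real.sInf_empty] at h1
        exact hlam.ne h1
      obtain ⟨t, ⟨-, ht⟩, htlt⟩ := exists_lt_of_csInf_lt hne
        (show pencilEigenvalue (T χ₀) (J χ₀) (k + m - 1) < lam + δ by rw [h1]; linarith)
      have h2 := ht.trans (pencilCount_mono (le_max_left t lam))
      rw [hν.pencilCount_eq hs₀ ha0 haδ hn₀ (halam.le.trans (le_max_right _ _))
        (max_lt htlt (by linarith)), Nat.cast_le] at h2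
      refine h2.trans (Nat.add_le_add_left ?_ n)
      rw [Nat.card_eq_fintype_card]
      exact (Fintype.card_subtype_le _).trans (Fintype.card_fin m).le
    omega
  filter_upwards [hall] with χ hχ
  obtain ⟨b, hb⟩ := hχ
  refine ⟨b, fun i => ?_⟩
  rw [hb, hkn, add_right_comm]

end Labelling

/-! ### Elementary symmetric functions of eigenvalues -/

section Symmetric

open Filter Topology ContDiff Asymptotics

theorem contDiff_charpoly_coeff {W : Type*} [NormedAddCommGroup W] [NormedSpace ℂ W]
    [FiniteDimensional ℂ W] (i : ℕ) :
    ContDiff ℂ ω (fun M : W →L[ℂ] W => (M : W →ₗ[ℂ] W).charpoly.coeff i) := by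
  classical
  set b := Module.finBasis ℂ W
  have hentry : ∀ q : Fin _ × Fin _,
      ContDiff ℂ ω (fun M : W →L[ℂ] W => LinearMap.toMatrix b b (M : W →ₗ[ℂ] W) q.1 q.2) := by
    intro q
    have h1 : ContDiff ℂ ω (fun M : W →L[ℂ] W =>
        LinearMap.toContinuousLinearMap (b.coord q.1) (M (b q.2))) :=
      (ContinuousLinearMap.contDiff _).comp (contDiff_id.clm_apply contDiff_const)
    convert h1 using 2 with M
    simp [LinearMap.toMatrix_apply]
  have hpoly : ∀ p : MvPolynomial (Fin _ × Fin _) ℂ, ContDiff ℂ ω (fun M : W →L[ℂ] W =>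
      MvPolynomial.eval (fun q => LinearMap.toMatrix b b (M : W →ₗ[ℂ] W) q.1 q.2) p) := by
    intro p
    induction p using MvPolynomial.induction_on with
    | C a => simpa using contDiff_const
    | add p q hp hq => simpa using hp.add hq
    | mul_X p q hp => simpa using hp.mul (hentry q)
  convert hpoly ((Matrix.charpoly.univ ℂ (Fin _)).coeff i) using 2 with M
  rw [← LinearMap.charpoly_toMatrix (M : W →ₗ[ℂ] W) b]
  exact (Matrix.charpoly.univ_coeff_eval₂Hom (Fin _) (RingHom.id ℂ)
    (fun q => LinearMap.toMatrix b b (M : W →ₗ[ℂ] W) q.1 q.2) i).symm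

section Eigenbasis

variable {W : Type*} [AddCommGroup W] [Module ℂ W] {m : ℕ} (b : Module.Basis (Fin m) ℂ W)
  {M : W →ₗ[ℂ] W} {ν : Fin m → ℝ} (hM : ∀ i, M (b i) = (ν i : ℂ) • b i)
include hM

theorem toMatrix_eq_diagonal_of_eigenbasis :
    LinearMap.toMatrix b b M = Matrix.diagonal fun i => (ν i : ℂ) := by
  ext i j
  rw [LinearMap.toMatrix_apply, hM, map_smul, Module.Basis.repr_self, Matrix.diagonal_apply]
  by_cases h : i = j
  · simp [h]
  · simp [h]

theorem trace_eq_sum_of_eigenbasis : LinearMap.trace ℂ W M = ∑ i, (ν i : ℂ) := by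
  rw [LinearMap.trace_eq_matrix_trace ℂ b, toMatrix_eq_diagonal_of_eigenbasis b hM,
    Matrix.trace_diagonal]

theorem sum_prod_powersetCard_eq_charpoly_coeff [FiniteDimensional ℂ W] {s : ℕ} (hs : s ≤ m) :
    ∑ S ∈ (Finset.univ : Finset (Fin m)).powersetCard s, ∏ i ∈ S, ν i =
      ((-1) ^ s * M.charpoly.coeff (m - s)).re := by
  have hprod : M.charpoly =
      (Multiset.map (fun t => Polynomial.X - Polynomial.C t)
        (Multiset.map (fun i => (ν i : ℂ)) (Finset.univ : Finset (Fin m)).val)).prod := by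
    rw [← LinearMap.charpoly_toMatrix M b, toMatrix_eq_diagonal_of_eigenbasis b hM,
      Matrix.charpoly_diagonal, Multiset.map_map]
    rfl
  rw [hprod, Multiset.prod_X_sub_C_coeff _ (by simp), Finset.esymm_map_val]
  have hcard : Multiset.card
      (Multiset.map (fun i => (ν i : ℂ)) (Finset.univ : Finset (Fin m)).val) - (m - s) = s := by
    simp only [Multiset.card_map, Finset.card_val, Finset.card_univ, Fintype.card_fin]
    omega
  rw [hcard, ← mul_assoc, ← mul_pow, neg_one_mul, neg_neg, one_pow, one_mul]
  rw [← Complex.ofReal_re (∑ S ∈ _, _)]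
  push_cast
  rfl

end Eigenbasis

theorem sum_powersetCard_Icc (f : ℕ → ℝ) (k : ℕ) {m : ℕ} (hm : 1 ≤ m) (s : ℕ) :
    ∑ S ∈ (Finset.Icc k (k + m - 1)).powersetCard s, ∏ j ∈ S, f j =
      ∑ S ∈ (Finset.univ : Finset (Fin m)).powersetCard s, ∏ i ∈ S, f (k + i) := by
  set φ : Fin m ↪ ℕ := ⟨fun i => k + i, fun i j hij => Fin.ext (Nat.add_left_cancel hij)⟩
  have hmap : Finset.Icc k (k + m - 1) = Finset.univ.map φ := by
    ext j
    simp only [Finset.mem_Icc, Finset.mem_map, Finset.mem_univ, true_and]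
    constructor
    · rintro ⟨h1, h2⟩
      exact ⟨⟨j - k, by omega⟩, by change k + (j - k) = j; omega⟩
    · rintro ⟨i, rfl⟩
      change k ≤ k + i ∧ k + i ≤ k + m - 1
      omega
  rw [hmap, Finset.powersetCard_map, Finset.sum_map]
  refine Finset.sum_congr rfl fun S _ => ?_
  exact Finset.prod_map S φ f

theorem sum_powersetCard_sum {m : ℕ} (y : Fin m → ℝ) {s : ℕ} (hs : 1 ≤ s) :
    ∑ S ∈ (Finset.univ : Finset (Fin m)).powersetCard s, ∑ i ∈ S, y i =
      ((m - 1).choose (s - 1) : ℝ) * ∑ i, y i := by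
  classical
  have h1 : ∀ S : Finset (Fin m), ∑ i ∈ S, y i = ∑ i, if i ∈ S then y i else 0 := fun S => by simp
  rw [Finset.sum_congr rfl fun S _ => h1 S]
  rw [Finset.sum_comm, Finset.mul_sum]
  refine Finset.sum_congr rfl fun i _ => ?_
  rw [← Finset.sum_filter, Finset.sum_const, nsmul_eq_mul]
  have h2 := Finset.card_filter_powersetCard_subset ({i} : Finset (Fin m)) Finset.univ s
    (Finset.subset_univ _) (by simpa using hs)
  simp only [Finset.singleton_subset_iff, Finset.card_univ, Fintype.card_fin,
    Finset.card_singleton] at h2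
  rw [h2]

/-- First-order expansion of a product of factors that all tend to `lam` at least linearly. -/
theorem isBigO_prod_sub {ι : Type*} [DecidableEq ι] {x : ι → ℝ → ℝ} {lam : ℝ}
    (hx : ∀ i, (fun t => x i t - lam) =O[𝓝 0] fun t : ℝ => t) (S : Finset ι) :
    (fun t => ∏ i ∈ S, x i t - lam ^ S.card - lam ^ (S.card - 1) * ∑ i ∈ S, (x i t - lam))
      =O[𝓝 0] fun t : ℝ => t ^ 2 := by
  induction S using Finset.induction_on with
  | empty => simpa using isBigO_zero _ _
  | insert a S ha ih =>
    have hsum : (fun t => ∑ i ∈ S, (x i t - lam)) =O[𝓝 0] fun t : ℝ => t :=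
      IsBigO.fun_sum fun i _ => hx i
    have h1 : (fun t => (x a t - lam) * (lam ^ (S.card - 1) * ∑ i ∈ S, (x i t - lam)))
        =O[𝓝 0] fun t : ℝ => t ^ 2 := by
      simpa [sq] using (hx a).mul (hsum.const_mul_left (lam ^ (S.card - 1)))
    have hbdd : (fun t => x a t) =O[𝓝 0] fun _ : ℝ => (1 : ℝ) := by
      have h2 : (fun t : ℝ => t) =O[𝓝 0] fun _ : ℝ => (1 : ℝ) :=
        (continuous_id.tendsto (0 : ℝ)).isBigO_one ℝ
      have h3 := ((hx a).trans h2).add (isBigO_const_const lam one_ne_zero (𝓝 (0 : ℝ)))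
      simpa using h3
    have h4 := hbdd.mul ih
    simp only [one_mul] at h4
    refine (h1.add h4).congr_left fun t => ?_
    rw [Finset.prod_insert ha, Finset.sum_insert ha, Finset.card_insert_of_notMem ha,
      Nat.add_sub_cancel]
    rcases Nat.eq_zero_or_pos S.card with h0 | h0
    · rw [Finset.card_eq_zero.1 h0]
      simp
    · have hp : lam ^ S.card = lam * lam ^ (S.card - 1) := by
        rw [← pow_succ', Nat.sub_add_cancel h0]
      rw [pow_succ, hp]
      ring

/-- At a point where all arguments equal `lam`, the elementary symmetric function of degree `s` has
the derivative of a multiple of the sum of the arguments, even if the single arguments are only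
Lipschitz at that point. -/
theorem hasDerivAt_sum_prod_powersetCard {m : ℕ} {x : Fin m → ℝ → ℝ} {lam d : ℝ}
    (hx : ∀ i, (fun t => x i t - lam) =O[𝓝 0] fun t : ℝ => t)
    (hd : HasDerivAt (fun t => ∑ i, x i t) d 0) {s : ℕ} (hs : 1 ≤ s) :
    HasDerivAt (fun t => ∑ S ∈ (Finset.univ : Finset (Fin m)).powersetCard s, ∏ i ∈ S, x i t)
      (lam ^ (s - 1) * ((m - 1).choose (s - 1) : ℝ) * d) 0 := by
  set R : ℝ → ℝ := fun t => ∑ S ∈ (Finset.univ : Finset (Fin m)).powersetCard s,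
    (∏ i ∈ S, x i t - lam ^ S.card - lam ^ (S.card - 1) * ∑ i ∈ S, (x i t - lam)) with hR
  have hRO : R =O[𝓝 0] fun t : ℝ => t ^ 2 := IsBigO.fun_sum fun S _ => isBigO_prod_sub hx S
  have hR0 : R 0 = 0 := by
    exact hRO.eq_zero_imp.self_of_nhds (by simp)
  have hRd : HasDerivAt R 0 0 := by
    rw [hasDerivAt_iff_isLittleO]
    simp only [hR0, sub_zero, smul_zero]
    exact hRO.trans_isLittleO (isLittleO_pow_id one_lt_two)
  have hmain : HasDerivAt (fun t => lam ^ (s - 1) *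
      (((m - 1).choose (s - 1) : ℝ) * ∑ i, (x i t - lam))) (lam ^ (s - 1) *
      (((m - 1).choose (s - 1) : ℝ) * d)) 0 := by
    have h1 : HasDerivAt (fun t => ∑ i, (x i t - lam)) d 0 := by
      simpa [Finset.sum_sub_distrib] using hd.sub_const (∑ _i : Fin m, lam)
    exact (h1.const_mul _).const_mul _
  have hfinal := (hRd.add hmain).add_const
    (∑ S ∈ (Finset.univ : Finset (Fin m)).powersetCard s, lam ^ s)
  rw [zero_add, ← mul_assoc] at hfinal
  refine hfinal.congr_of_eventuallyEq (Eventually.of_forall fun t => ?_)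
  change ∑ S ∈ (Finset.univ : Finset (Fin m)).powersetCard s, ∏ i ∈ S, x i t =
    R t + lam ^ (s - 1) * (((m - 1).choose (s - 1) : ℝ) * ∑ i, (x i t - lam)) + _
  rw [← sum_powersetCard_sum _ hs, Finset.mul_sum, hR, ← Finset.sum_add_distrib,
    ← Finset.sum_add_distrib]
  refine Finset.sum_congr rfl fun S hS => ?_
  rw [(Finset.mem_powersetCard.1 hS).2]
  ring

end Symmetric

/-! ### The derivative of the trace, and families of pencils -/

section Derivative

open Filter Topology ContDiff Asymptotics

theorem HasDerivAt.complexClm_apply {A B : Type*} [NormedAddCommGroup A] [NormedSpace ℂ A]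
    [NormedAddCommGroup B] [NormedSpace ℂ B] {L : ℝ → A →L[ℂ] B} {x : ℝ → A} {L' : A →L[ℂ] B}
    {x' : A} {t : ℝ} (hL : HasDerivAt L L' t) (hx : HasDerivAt x x' t) :
    HasDerivAt (fun s => L s (x s)) (L' (x t) + L t x') t := by
  have h1 : HasFDerivAt (𝕜 := ℂ) (fun p : (A →L[ℂ] B) × A => p.1 p.2) _ (L t, x t) :=
    isBoundedBilinearMap_apply.hasFDerivAt (L t, x t)
  have h2 := (h1.restrictScalars ℝ).comp_hasDerivAt t (hL.prodMk hx)
  convert! h2 using 1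
  simp [add_comm]

theorem isBigO_norm_sub_of_differentiableAt {W : Type*} [NormedAddCommGroup W] [NormedSpace ℂ W]
    {M : ℝ → W →L[ℂ] W} (hM : DifferentiableAt ℝ M 0) :
    (fun t => ‖M t - M 0‖) =O[𝓝 0] fun t : ℝ => t := by
  simpa using hM.isBigO_sub.norm_left

variable {E : Type*} [NormedAddCommGroup E] [InnerProductSpace ℂ E]

/-- The derivative at `t = 0` of the trace of `M t`, where `T U = J U M`. Differentiating this
identity and pairing it with the eigenvectors `ι (w h)`, the derivative of `U` drops out since
`T 0 - lam J 0` is symmetric. -/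
theorem hasDerivAt_trace_of_frame {T J : ℝ → E →L[ℂ] E} {T' J' : E →L[ℂ] E}
    (hT : HasDerivAt T T' 0) (hJ : HasDerivAt J J' 0) (hsymm : IsSymmetricPencil (T 0) (J 0))
    {lam : ℝ} {m : ℕ} {W : Type*} [NormedAddCommGroup W] [NormedSpace ℂ W]
    [FiniteDimensional ℂ W] (hm : Module.finrank ℂ W = m) (ι : W →L[ℂ] E)
    (hW : ∀ w, T 0 (ι w) = (lam : ℂ) • J 0 (ι w))
    {U : ℝ → W →L[ℂ] E} {M : ℝ → W →L[ℂ] W} (hU : DifferentiableAt ℝ U 0)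
    (hM : DifferentiableAt ℝ M 0) (hU0 : U 0 = ι)
    (hM0 : M 0 = (lam : ℂ) • ContinuousLinearMap.id ℂ W)
    (hUM : ∀ᶠ t in 𝓝 0, ∀ w, T t (U t w) = J t (U t (M t w)))
    (w : Fin m → W)
    (horth : ∀ h l, inner ℂ (ι (w l)) (J 0 (ι (w h))) = if h = l then 1 else 0) :
    HasDerivAt (fun t => LinearMap.trace ℂ W (M t : W →ₗ[ℂ] W))
      (∑ h, inner ℂ (ι (w h)) (T' (ι (w h)) - (lam : ℂ) • J' (ι (w h)))) 0 := by
  classical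
  have hli : LinearIndependent ℂ w := by
    rw [Fintype.linearIndependent_iff]
    intro c hc i
    have h1 : inner ℂ (ι (w i)) (J 0 (ι (∑ h, c h • w h))) = c i := by
      simp [horth]
    rw [hc] at h1
    simpa using h1.symm
  set b : Module.Basis (Fin m) ℂ W :=
    basisOfLinearIndependentOfCardEqFinrank' w hli (by simp [hm]) with hb
  have hbw : ∀ h, b h = w h := fun h => by simp [hb]
  have hcoord : ∀ (h : Fin m) (x : W), b.repr x h = inner ℂ (ι (w h)) (J 0 (ι x)) := by
    intro h x
    conv_rhs => rw [← b.sum_repr x]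
    simp [hbw, horth]
  have htrace : ∀ t, LinearMap.trace ℂ W (M t : W →ₗ[ℂ] W) =
      ∑ h, inner ℂ (ι (w h)) (J 0 (ι (M t (w h)))) := by
    intro t
    rw [LinearMap.trace_eq_matrix_trace ℂ b, Matrix.trace]
    refine Finset.sum_congr rfl fun h _ => ?_
    rw [Matrix.diag_apply, LinearMap.toMatrix_apply, hcoord, hbw]
    rfl
  simp_rw [htrace]
  refine HasDerivAt.fun_sum fun h _ => ?_
  set U' := deriv U 0
  set M' := deriv M 0
  have hUd : HasDerivAt U U' 0 := hU.hasDerivAt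
  have hMw : HasDerivAt (fun t => M t (w h)) (M' (w h)) 0 := by
    simpa using hM.hasDerivAt.complexClm_apply (hasDerivAt_const 0 (w h))
  have hder : HasDerivAt (fun t => inner ℂ (ι (w h)) (J 0 (ι (M t (w h)))))
      (inner ℂ (ι (w h)) (J 0 (ι (M' (w h))))) 0 := by
    simpa using (hasDerivAt_const (0 : ℝ) (innerSL ℂ (ι (w h)) ∘L J 0 ∘L ι)).complexClm_apply
      hMw
  convert! hder using 1
  have hleft : HasDerivAt (fun t => T t (U t (w h))) (T' (ι (w h)) + T 0 (U' (w h))) 0 := by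
    have h1 : HasDerivAt (fun t => U t (w h)) (U' (w h)) 0 := by
      simpa using hUd.complexClm_apply (hasDerivAt_const 0 (w h))
    have h2 := hT.complexClm_apply h1
    rw [hU0] at h2
    exact h2
  have hright : HasDerivAt (fun t => J t (U t (M t (w h))))
      (J' ((lam : ℂ) • ι (w h)) + J 0 (U' ((lam : ℂ) • w h) + ι (M' (w h)))) 0 := by
    have h1 := hUd.complexClm_apply hMw
    have h2 := hJ.complexClm_apply h1
    rw [hU0, hM0] at h2
    simpa using h2
  have heq : T' (ι (w h)) + T 0 (U' (w h)) =
      J' ((lam : ℂ) • ι (w h)) + J 0 (U' ((lam : ℂ) • w h) + ι (M' (w h))) :=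
    hleft.unique (hright.congr_of_eventuallyEq (hUM.mono fun t ht => ht (w h)))
  have hcancel : inner ℂ (ι (w h)) (T 0 (U' (w h))) =
      (lam : ℂ) * inner ℂ (ι (w h)) (J 0 (U' (w h))) := by
    rw [← hsymm.symm_left, hW, inner_smul_left, Complex.conj_ofReal, hsymm.symm_right]
  have h3 := congrArg (fun z => inner ℂ (ι (w h)) z) heq
  simp only [inner_add_right, map_add, map_smul, inner_smul_right, hcancel] at h3
  rw [inner_sub_right, inner_smul_right]
  linear_combination h3

variable [CompleteSpace E] {X : Type*} [NormedAddCommGroup X] [NormedSpace ℝ X]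

/-- Regularity and derivative of the symmetric functions of an eigenvalue group, for families of
symmetric pencils. The hypothesis `hunit` is the Fredholm property of the pencil, needed for all
`μ ≤ lam` since the labels of the eigenvalues depend on all smaller ones. -/
theorem contDiffAt_and_hasLineDerivAt_symm_pencilEigenvalue {T J : X → E →L[ℂ] E} {χ₀ : X}
    {r : WithTop ℕ∞} (hr : 1 ≤ r)
    (hT : ∀ᶠ χ in 𝓝 χ₀, ContDiffAt ℝ r T χ) (hJ : ∀ᶠ χ in 𝓝 χ₀, ContDiffAt ℝ r J χ)
    (hsymm : ∀ᶠ χ in 𝓝 χ₀, IsSymmetricPencil (T χ) (J χ)) {lam : ℝ} (hlam : 0 < lam)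
    (hunit : ∀ μ ∈ Set.Ioc 0 lam,
      ∃ _ : FiniteDimensional ℂ (pencilEigenspace (T χ₀) (J χ₀) μ),
        IsUnit (borderedPencil (T χ₀) (J χ₀) μ (pencilEigenspace (T χ₀) (J χ₀) μ)))
    {ε : ℝ} (hε : 0 < ε)
    (hgap : ∀ᶠ χ in 𝓝 χ₀, ∀ μ ∈ Set.Ioo 0 ε, pencilEigenspace (T χ) (J χ) μ = ⊥)
    {k m : ℕ} (hk : 1 ≤ k) (hm1 : 1 ≤ m)
    (hm : Module.finrank ℂ (pencilEigenspace (T χ₀) (J χ₀) lam) = m)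
    (hindex : ∀ j ∈ Finset.Icc k (k + m - 1), pencilEigenvalue (T χ₀) (J χ₀) j = lam)
    {s : ℕ} (hs : s ∈ Finset.Icc 1 m) :
    (∀ᶠ χ in 𝓝 χ₀, ContDiffAt ℝ r (fun χ => ∑ S ∈ (Finset.Icc k (k + m - 1)).powersetCard s,
        ∏ j ∈ S, pencilEigenvalue (T χ) (J χ) j) χ) ∧
    ∀ u : Fin m → E, (∀ h, u h ∈ pencilEigenspace (T χ₀) (J χ₀) lam) →
      (∀ h l, inner ℂ (u l) (J χ₀ (u h)) = if h = l then 1 else 0) → ∀ v : X,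
      HasLineDerivAt ℝ (fun χ => ∑ S ∈ (Finset.Icc k (k + m - 1)).powersetCard s,
        ∏ j ∈ S, pencilEigenvalue (T χ) (J χ) j)
        (lam ^ (s - 1) * ((m - 1).choose (s - 1) : ℝ) *
          ∑ h, (inner ℂ (u h) (fderiv ℝ T χ₀ v (u h) - (lam : ℂ) • fderiv ℝ J χ₀ v (u h))).re)
        χ₀ v := by
  rw [Finset.mem_Icc] at hs
  obtain ⟨W, hW⟩ : ∃ W, W = pencilEigenspace (T χ₀) (J χ₀) lam := ⟨_, rfl⟩
  have : FiniteDimensional ℂ W := by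
    obtain ⟨hfin, -⟩ := hunit lam ⟨hlam, le_rfl⟩
    rwa [hW]
  have hWeig : ∀ w ∈ W, T χ₀ w = (lam : ℂ) • J χ₀ w := fun w hw => by
    rw [hW] at hw
    exact mem_pencilEigenspace.1 hw
  rw [← hW] at hm
  have hr0 : r ≠ 0 := (zero_lt_one.trans_le hr).ne'
  have hT0 := hT.self_of_nhds
  have hJ0 := hJ.self_of_nhds
  obtain ⟨U, M, hU0, hM0, hUC, hMC, hUM, hlab⟩ := exists_analytic_labelled_group
    hT0.continuousAt hJ0.continuousAt hsymm hlam hunit hε hgap hk hm1 W hW hm hindex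
  set p : X → (E →L[ℂ] E) × (E →L[ℂ] E) := fun χ => (T χ, J χ) with hp
  have hpC : ∀ᶠ χ in 𝓝 χ₀, ContDiffAt ℝ r p χ := by
    filter_upwards [hT, hJ] with χ h1 h2 using h1.prodMk h2
  have hptend : Tendsto p (𝓝 χ₀) (𝓝 (T χ₀, J χ₀)) := hpC.self_of_nhds.continuousAt.tendsto
  have hω : (ω : WithTop ℕ∞) ≠ ((⊤ : ℕ∞) : WithTop ℕ∞) := by simp
  constructor
  · -- near `χ₀` the symmetric function is a coefficient of the characteristic polynomial of `M`
    have hMχ : ∀ᶠ χ in 𝓝 χ₀, ContDiffAt ℝ r (fun χ => M (p χ)) χ := by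
      filter_upwards [hpC, hptend.eventually (hMC.eventually hω)] with χ h1 h2
      exact ((h2.restrict_scalars ℝ).of_le le_top).comp χ h1
    filter_upwards [hMχ, hlab.eventually_nhds] with χ h1 h2
    have h3 : ContDiffAt ℝ r (fun χ =>
        ((-1) ^ s * (M (p χ) : W →ₗ[ℂ] W).charpoly.coeff (m - s)).re) χ := by
      have h4 : ContDiff ℝ r (fun N : W →L[ℂ] W => (N : W →ₗ[ℂ] W).charpoly.coeff (m - s)) :=
        ((contDiff_charpoly_coeff (m - s)).restrict_scalars ℝ).of_le le_top
      have h5 : ContDiff ℝ r (fun z : ℂ => ((-1) ^ s * z).re) :=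
        Complex.reCLM.contDiff.comp (contDiff_const.mul contDiff_id)
      exact (h5.comp h4).contDiffAt.comp χ h1
    refine h3.congr_of_eventuallyEq ?_
    filter_upwards [h2] with χ' hχ'
    obtain ⟨b, hb⟩ := hχ'
    rw [sum_powersetCard_Icc _ _ hm1]
    exact sum_prod_powersetCard_eq_charpoly_coeff b hb hs.2
  · intro u hu horth v
    rw [← hW] at hu
    set γ : ℝ → X := fun t => χ₀ + t • v with hγ
    have hγ0 : γ 0 = χ₀ := by simp [hγ]
    have hγd : HasDerivAt γ v 0 := by
      simpa [hγ] using ((hasDerivAt_id (0 : ℝ)).smul_const v).const_add χ₀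
    have hγtend : Tendsto γ (𝓝 0) (𝓝 χ₀) := by
      have := hγd.continuousAt.tendsto
      rwa [hγ0] at this
    have hTd : HasDerivAt (fun t => T (γ t)) (fderiv ℝ T χ₀ v) 0 :=
      (hT0.differentiableAt hr0).hasFDerivAt.comp_hasDerivAt_of_eq 0 hγd hγ0.symm
    have hJd : HasDerivAt (fun t => J (γ t)) (fderiv ℝ J χ₀ v) 0 :=
      (hJ0.differentiableAt hr0).hasFDerivAt.comp_hasDerivAt_of_eq 0 hγd hγ0.symm
    have hpd : DifferentiableAt ℝ (fun t => p (γ t)) 0 := (hTd.prodMk hJd).differentiableAt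
    have hpγ0 : p (γ 0) = (T χ₀, J χ₀) := by rw [hγ0]
    have hωr : (ω : WithTop ℕ∞) ≠ 0 := by simp
    have hUd : DifferentiableAt ℝ (fun t => U (p (γ t))) 0 := by
      have h1 : DifferentiableAt ℝ U (p (γ 0)) := by
        rw [hpγ0]
        exact (hUC.restrict_scalars ℝ).differentiableAt hωr
      exact DifferentiableAt.comp (g := U) (f := fun t => p (γ t)) 0 h1 hpd
    have hMd : DifferentiableAt ℝ (fun t => M (p (γ t))) 0 := by
      have h1 : DifferentiableAt ℝ M (p (γ 0)) := by
        rw [hpγ0]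
        exact (hMC.restrict_scalars ℝ).differentiableAt hωr
      exact DifferentiableAt.comp (g := M) (f := fun t => p (γ t)) 0 h1 hpd
    have htr := hasDerivAt_trace_of_frame (T := fun t => T (γ t)) (J := fun t => J (γ t))
      hTd hJd (by simpa only [hγ0] using hsymm.self_of_nhds) hm
      W.subtypeL (fun w => by simpa only [hγ0, Submodule.subtypeL_apply] using hWeig w w.2) hUd hMd
      (by rw [hpγ0, hU0]) (by rw [hpγ0, hM0])
      ((hptend.comp hγtend).eventually hUM) (fun h => ⟨u h, hu h⟩)
      (by simpa only [hγ0, Submodule.subtypeL_apply] using horth)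
    have hlabγ := hγtend.eventually hlab
    -- the single eigenvalues are Lipschitz at `t = 0`, since `M` is a multiple of the identity there
    have hx : ∀ i : Fin m, (fun t => pencilEigenvalue (T (γ t)) (J (γ t)) (k + i) - lam)
        =O[𝓝 0] fun t : ℝ => t := by
      intro i
      refine IsBigO.trans (IsBigO.of_bound 1 ?_) (isBigO_norm_sub_of_differentiableAt hMd)
      filter_upwards [hlabγ] with t ht
      obtain ⟨b, hb⟩ := ht
      rw [Real.norm_eq_abs, one_mul, norm_norm, hpγ0, hM0]
      exact abs_sub_le_of_apply_eq_smul (b.ne_zero i) (hb i)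
    have hd : HasDerivAt (fun t => ∑ i : Fin m, pencilEigenvalue (T (γ t)) (J (γ t)) (k + i))
        (∑ h, (inner ℂ (u h) (fderiv ℝ T χ₀ v (u h) - (lam : ℂ) • fderiv ℝ J χ₀ v (u h))).re)
        0 := by
      have h1 := Complex.reCLM.hasFDerivAt.comp_hasDerivAt (0 : ℝ) htr
      rw [Complex.reCLM_apply, Complex.re_sum] at h1
      refine h1.congr_of_eventuallyEq ?_
      filter_upwards [hlabγ] with t ht
      obtain ⟨b, hb⟩ := ht
      change _ = (LinearMap.trace ℂ W (M (p (γ t)) : W →ₗ[ℂ] W)).re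
      rw [trace_eq_sum_of_eigenbasis b hb]
      simp
    have hfin := hasDerivAt_sum_prod_powersetCard hx hd hs.1
    exact hfin.congr_of_eventuallyEq (Eventually.of_forall fun t =>
      sum_powersetCard_Icc (fun j => pencilEigenvalue (T (γ t)) (J (γ t)) j) k hm1 s)

end Derivative

/-! ### The pencil of an operator family -/

section GraphSpace

open Filter Topology

variable {H0 H1 : Type*} [NormedAddCommGroup H0] [InnerProductSpace ℂ H0]
  [NormedAddCommGroup H1] [InnerProductSpace ℂ H1] {V : Submodule ℂ H0}

/-- The graph norm is the norm of the scalar product that makes `u ↦ (u, A u)` isometric. -/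
noncomputable instance GraphDomain.instInnerProductSpace (A : V →ₗ[ℂ] H1) :
    InnerProductSpace ℂ (GraphDomain A) where
  inner u v := inner ℂ (GraphDomain.toGraph A u) (GraphDomain.toGraph A v)
  norm_sq_eq_re_inner u := norm_sq_eq_re_inner (𝕜 := ℂ) (GraphDomain.toGraph A u)
  conj_inner_symm u v := inner_conj_symm _ _
  add_left u v w := by rw [map_add, inner_add_left]
  smul_left u v c := by rw [map_smul, inner_smul_left]

theorem GraphDomain.norm_sq_eq (A : V →ₗ[ℂ] H1) (u : GraphDomain A) :
    ‖u‖ ^ 2 = ‖(GraphDomain.toDomain A u : H0)‖ ^ 2 + ‖A (GraphDomain.toDomain A u)‖ ^ 2 :=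
  WithLp.prod_norm_sq_eq_of_L2 (GraphDomain.toGraph A u)

theorem GraphDomain.completeSpace [CompleteSpace H0] [CompleteSpace H1] (A : V →ₗ[ℂ] H1)
    (hA : (LinearPMap.mk V A).IsClosed) : CompleteSpace (GraphDomain A) := by
  have hiso : Isometry (GraphDomain.toGraph A) :=
    AddMonoidHomClass.isometry_of_norm _ fun _ => rfl
  refine (completeSpace_iff_isComplete_range hiso.isUniformInducing).2 (IsClosed.isComplete ?_)
  have hrange : Set.range (GraphDomain.toGraph A) =
      (WithLp.ofLp : WithLp 2 (H0 × H1) → H0 × H1) ⁻¹' ((LinearPMap.mk V A).graph) := by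
    ext x
    simp only [Set.mem_range, Set.mem_preimage, SetLike.mem_coe, LinearPMap.mem_graph_iff]
    constructor
    · rintro ⟨u, rfl⟩
      exact ⟨GraphDomain.toDomain A u, rfl, rfl⟩
    · rintro ⟨u, h1, h2⟩
      refine ⟨(GraphDomain.toDomain A).symm u, ?_⟩
      exact (WithLp.linearEquiv 2 ℂ (H0 × H1)).injective (Prod.ext h1 h2)
  rw [hrange]
  exact hA.preimage (WithLp.prod_continuous_ofLp 2 H0 H1)

end GraphSpace

section Riesz

variable (E : Type*) [NormedAddCommGroup E] [InnerProductSpace ℂ E] [CompleteSpace E]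

theorem bijective_innerSLFlip :
    Function.Bijective (innerSLFlip ℂ : E →L[ℂ] E →L⋆[ℂ] ℂ) := by
  constructor
  · intro x y hxy
    refine ext_inner_left ℂ fun v => ?_
    exact congrArg (fun f : E →L⋆[ℂ] ℂ => f v) hxy
  · intro f
    refine ⟨(InnerProductSpace.toDual ℂ E).symm
      ((starL ℂ : ℂ ≃L⋆[ℂ] ℂ).toContinuousLinearMap.comp f), ?_⟩
    ext v
    rw [innerSLFlip_apply_apply, ← inner_conj_symm, InnerProductSpace.toDual_symm_apply]
    simp

/-- The Riesz isomorphism, from antilinear functionals to vectors. -/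
noncomputable def rieszInverse : (E →L⋆[ℂ] ℂ) →L[ℂ] E :=
  (ContinuousLinearEquiv.ofBijective (innerSLFlip ℂ : E →L[ℂ] E →L⋆[ℂ] ℂ)
    (LinearMap.ker_eq_bot.2 (bijective_innerSLFlip E).1)
    (LinearMap.range_eq_top.2 (bijective_innerSLFlip E).2)).symm

variable {E}

theorem inner_rieszInverse (f : E →L⋆[ℂ] ℂ) (v : E) : inner ℂ v (rieszInverse E f) = f v := by
  rw [← innerSLFlip_apply_apply ℂ (rieszInverse E f) v]
  exact congrArg (fun g : E →L⋆[ℂ] ℂ => g v)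
    (ContinuousLinearEquiv.ofBijective_apply_symm_apply
      (innerSLFlip ℂ : E →L[ℂ] E →L⋆[ℂ] ℂ) _ _ f)

end Riesz

namespace OperatorFamily

open Filter Topology

variable {X H0 H1 : Type*} [NormedAddCommGroup X] [NormedSpace ℝ X]
  [NormedAddCommGroup H0] [InnerProductSpace ℂ H0]
  [NormedAddCommGroup H1] [InnerProductSpace ℂ H1] (F : OperatorFamily X H0 H1)

/-- The identity of `V`, as a map from `V` with its fixed graph norm. -/
def toV (u : F.VSpace) : F.V := GraphDomain.toDomain (F.A F.ref) u

/-- The inclusion of `V`, with its fixed graph norm, into `H0`. -/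
noncomputable def inclusion : F.VSpace →L[ℂ] H0 :=
  LinearMap.mkContinuous (F.V.subtype ∘ₗ (GraphDomain.toDomain (F.A F.ref)).toLinearMap) 1 (by
    intro u
    rw [one_mul]
    refine le_of_sq_le_sq ?_ (norm_nonneg u)
    rw [GraphDomain.norm_sq_eq]
    exact le_add_of_nonneg_right (sq_nonneg _))

theorem inclusion_injective : Function.Injective F.inclusion := fun _ _ h =>
  (GraphDomain.toDomain (F.A F.ref)).injective (Subtype.ext h)

/-- `T` and `J` represent the forms `⟨A u, A v⟩₁` and `⟨u, v⟩₀` at `χ` on the Hilbert space `V`. -/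
structure IsRepresentedBy (χ : X) (T J : F.VSpace →L[ℂ] F.VSpace) : Prop where
  inner_left : ∀ u v, inner ℂ v (T u) = scp (F.ip1 χ) (F.A χ (F.toV u)) (F.A χ (F.toV v))
  inner_right : ∀ u v, inner ℂ v (J u) = scp (F.ip0 χ) (F.toV u : H0) (F.toV v : H0)

theorem conj_scp {H : Type*} [AddCommGroup H] [Module ℂ H] (c : InnerProductSpace.Core ℂ H)
    (x y : H) : (starRingEnd ℂ) (scp c x y) = scp c y x :=
  c.conj_inner_symm x y

theorem scp_self_eq_zero {H : Type*} [AddCommGroup H] [Module ℂ H]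
    (c : InnerProductSpace.Core ℂ H) {x : H} (h : scp c x x = 0) : x = 0 :=
  c.definite x h

theorem scp_smul_left {H : Type*} [AddCommGroup H] [Module ℂ H] (c : InnerProductSpace.Core ℂ H)
    (μ : ℂ) (x y : H) : scp c (μ • x) y = μ * scp c x y := by
  unfold scp
  rw [InnerProductSpace.Core.inner_smul_right]

theorem scp_zero_left {H : Type*} [AddCommGroup H] [Module ℂ H] (c : InnerProductSpace.Core ℂ H)
    (y : H) : scp c 0 y = 0 := by
  unfold scp
  rw [InnerProductSpace.Core.inner_zero_right]

namespace IsRepresentedBy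

variable {F} {χ : X} {T J : F.VSpace →L[ℂ] F.VSpace} (h : F.IsRepresentedBy χ T J)
include h

theorem isSymmetricPencil (hχ : χ ∈ F.params) : IsSymmetricPencil T J where
  symm_left u v := by rw [← inner_conj_symm, h.inner_left, h.inner_left, conj_scp]
  symm_right u v := by rw [← inner_conj_symm, h.inner_right, h.inner_right, conj_scp]
  pos u hu := by
    obtain ⟨a, b, ha, -, hab⟩ := F.equiv0 χ hχ
    rw [h.inner_right]
    refine lt_of_lt_of_le ?_ (hab _).1
    have hne : (F.toV u : H0) ≠ 0 := fun h0 =>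
      hu (F.inclusion_injective (h0.trans (map_zero F.inclusion).symm))
    have := norm_pos_iff.2 hne
    positivity

/-- The eigenspaces of `A^* A` are those of the pencil: pairing `A^* A u = μ u` with all `v ∈ V`
gives the pencil equation, tested with all `v`. -/
theorem eigenspace_eq_map (μ : ℝ) :
    F.eigenspace χ μ =
      (pencilEigenspace T J μ).map (F.inclusion : F.VSpace →ₗ[ℂ] H0) := by
  have key : ∀ u : F.VSpace, u ∈ pencilEigenspace T J μ ↔
      ∀ x : F.V, scp (F.ip1 χ) (F.A χ x) (F.A χ (F.toV u)) =
        scp (F.ip0 χ) (x : H0) ((μ : ℂ) • (F.toV u : H0)) := by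
    intro u
    have hx : ∀ v : F.VSpace, (scp (F.ip1 χ) (F.A χ (F.toV v)) (F.A χ (F.toV u)) =
        scp (F.ip0 χ) (F.toV v : H0) ((μ : ℂ) • (F.toV u : H0))) ↔
        inner ℂ v (T u) = inner ℂ v ((μ : ℂ) • J u) := by
      intro v
      rw [inner_smul_right, h.inner_left, h.inner_right,
        ← (starRingEnd ℂ).injective.eq_iff, conj_scp, conj_scp]
      rw [scp_smul_left]
    rw [mem_pencilEigenspace]
    constructor
    · intro hu x
      exact (hx ((GraphDomain.toDomain (F.A F.ref)).symm x)).2 (by rw [hu])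
    · intro hu
      exact ext_inner_left ℂ fun v => (hx v).1 (hu (F.toV v))
  ext y
  constructor
  · rintro ⟨u, hu, rfl⟩
    exact ⟨(GraphDomain.toDomain (F.A F.ref)).symm u, (key _).2 hu, rfl⟩
  · rintro ⟨u, hu, rfl⟩
    exact ⟨F.toV u, (key u).1 hu, rfl⟩

theorem eigenvalue_eq (j : ℕ) : F.eigenvalue χ j = pencilEigenvalue T J j := by
  have hrank : ∀ t : ℝ, Module.rank ℂ ↥(⨆ μ ∈ Set.Ioc 0 t, F.eigenspace χ μ) =
      pencilCount T J t := by
    intro t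
    have hmap : (⨆ μ ∈ Set.Ioc 0 t, F.eigenspace χ μ) =
        (pencilSpan T J (Set.Ioc 0 t)).map (F.inclusion : F.VSpace →ₗ[ℂ] H0) := by
      simp only [pencilSpan, Submodule.map_iSup, h.eigenspace_eq_map]
    rw [hmap, pencilCount]
    exact (Submodule.equivMapOfInjective (F.inclusion : F.VSpace →ₗ[ℂ] H0)
      F.inclusion_injective _).rank_eq.symm
  simp only [eigenvalue, pencilEigenvalue, hrank]

/-- The abstract Fredholm property applies: `T + J` is coercive because `⟨A u, A u⟩₁ + ⟨u, u⟩₀` is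
comparable to the squared graph norm, and `J` is compact on the reduced domain because it factors
through the embedding of that domain into `H0`. -/
theorem isUnit_borderedPencil [CompleteSpace F.VSpace] (hχ : χ ∈ F.params)
    {j : F.VAntidual →L[ℂ] F.VSpace} {J₀ : H0 →L[ℂ] F.VAntidual} (hJ : J = j ∘L J₀ ∘L F.inclusion)
    {μ : ℝ} (hμ : 0 < μ) [FiniteDimensional ℂ (pencilEigenspace T J μ)] :
    IsUnit (borderedPencil T J μ (pencilEigenspace T J μ)) := by
  have hsymm := h.isSymmetricPencil hχ
  obtain ⟨a₀, b₀, ha₀, -, hab₀⟩ := F.equiv0 χ hχ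
  obtain ⟨a₁, b₁, ha₁, -, hab₁⟩ := F.equiv1 χ hχ
  obtain ⟨C, hC⟩ := F.graphNorm_equiv F.ref F.ref_mem χ hχ
  obtain ⟨C', hC'⟩ := F.graphNorm_equiv χ hχ F.ref F.ref_mem
  -- the identity of `V`, from the fixed graph norm to the graph norm at `χ`
  let e : F.VSpace →ₗ[ℂ] GraphDomain (F.A χ) :=
    (GraphDomain.toDomain (F.A χ)).symm.toLinearMap ∘ₗ
      (GraphDomain.toDomain (F.A F.ref)).toLinearMap
  let eL : F.VSpace →L[ℂ] GraphDomain (F.A χ) := e.mkContinuous C' fun u => hC' (F.toV u)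
  set C₁ := max C 1 with hC₁
  have hC₁pos : 0 < C₁ := lt_of_lt_of_le one_pos (le_max_right _ _)
  have hnorm : ∀ u : F.VSpace, ‖u‖ ≤ C₁ * ‖e u‖ := fun u =>
    (hC (F.toV u)).trans (mul_le_mul_of_nonneg_right (le_max_left _ _) (norm_nonneg _))
  set a := min a₀ a₁ with ha
  have hapos : 0 < a := lt_min ha₀ ha₁
  have hcoer : ∀ u, a / C₁ ^ 2 * ‖u‖ ^ 2 ≤ (inner ℂ u ((T + J) u)).re := by
    intro u
    rw [add_apply, inner_add_right, h.inner_left, h.inner_right, Complex.add_re]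
    have h1 : ‖u‖ ^ 2 ≤ C₁ ^ 2 * ‖e u‖ ^ 2 := by
      rw [← mul_pow]
      exact pow_le_pow_left₀ (norm_nonneg _) (hnorm u) 2
    have h2 : ‖e u‖ ^ 2 = ‖(F.toV u : H0)‖ ^ 2 + ‖F.A χ (F.toV u)‖ ^ 2 :=
      GraphDomain.norm_sq_eq _ (e u)
    calc a / C₁ ^ 2 * ‖u‖ ^ 2 ≤ a / C₁ ^ 2 * (C₁ ^ 2 * ‖e u‖ ^ 2) := by gcongr
      _ = a * ‖F.A χ (F.toV u)‖ ^ 2 + a * ‖(F.toV u : H0)‖ ^ 2 := by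
        rw [h2]
        field_simp
        ring
      _ ≤ a₁ * ‖F.A χ (F.toV u)‖ ^ 2 + a₀ * ‖(F.toV u : H0)‖ ^ 2 := by
        gcongr
        · exact min_le_right _ _
        · exact min_le_left _ _
      _ ≤ _ := add_le_add (hab₁ _).1 (hab₀ _).1
  have hker : ∀ k : F.VSpace, T k = 0 ↔ F.A χ (F.toV k) = 0 := by
    intro k
    constructor
    · intro hk
      apply scp_self_eq_zero (F.ip1 χ)
      rw [← h.inner_left, hk, inner_zero_right]
    · intro hk
      refine ext_inner_left ℂ fun v => ?_
      rw [h.inner_left, hk, inner_zero_right, scp_zero_left]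
  let N : Submodule ℂ F.VSpace := (reducedDomain (F.ip0 χ) (F.A χ)).comap e
  have hN : ∀ u, u ∈ N ↔ ∀ k, T k = 0 → inner ℂ k (J u) = 0 := by
    intro u
    constructor
    · intro hu k hk
      rw [h.inner_right]
      exact hu (F.toV k) ((hker k).1 hk)
    · intro hu v hv
      have := hu ((GraphDomain.toDomain (F.A F.ref)).symm v) ((hker _).2 hv)
      rwa [h.inner_right] at this
  have hcomp : IsCompactOperator (fun u : N => J u) := by
    have h1 := (F.compact_embedding χ hχ).comp_clm
      ((eL ∘L N.subtypeL).codRestrict (reducedDomain (F.ip0 χ) (F.A χ)) fun u => u.2)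
    have h2 := h1.clm_comp (j ∘L J₀)
    rw [hJ]
    exact h2
  refine _root_.isUnit_borderedPencil hsymm.symm_left hsymm.symm_right (fun u hu h0 => ?_)
    (by positivity : 0 < a / C₁ ^ 2) hcoer N hN hcomp hμ _ rfl
  exact hu (hsymm.eq_zero_of_inner_eq_zero h0)

end IsRepresentedBy

variable {F}

/-- The pencil of a family of class `C^r`. The factorization of `J` through `H0` is what makes it
compact on the domain of the reduced operator. -/
theorem IsOfClass.exists_pencil [CompleteSpace F.VSpace] {r : WithTop ℕ∞} (hF : F.IsOfClass r) :
    ∃ T J : X → F.VSpace →L[ℂ] F.VSpace, ContDiffOn ℝ r T F.params ∧ ContDiffOn ℝ r J F.params ∧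
      (∀ χ ∈ F.params, F.IsRepresentedBy χ (T χ) (J χ)) ∧
      ∀ χ, ∃ (j : F.VAntidual →L[ℂ] F.VSpace) (J₀ : H0 →L[ℂ] F.VAntidual),
        J χ = j ∘L J₀ ∘L F.inclusion := by
  obtain ⟨𝒯, 𝒥, h𝒯, h𝒥, h𝒯C, h𝒥C⟩ := hF
  set ρ := rieszInverse F.VSpace
  refine ⟨fun χ => ρ ∘L 𝒯 χ, fun χ => ρ ∘L 𝒥 χ ∘L F.inclusion, ?_, ?_, fun χ hχ => ⟨?_, ?_⟩,
    fun χ => ⟨ρ, 𝒥 χ, rfl⟩⟩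
  · have h1 : ContDiff ℂ r (fun L : F.VSpace →L[ℂ] F.VAntidual => ρ ∘L L) :=
      contDiff_const.clm_comp contDiff_id
    exact (h1.restrict_scalars ℝ).comp_contDiffOn h𝒯C
  · have h1 : ContDiff ℂ r (fun L : H0 →L[ℂ] F.VAntidual => ρ ∘L L ∘L F.inclusion) :=
      contDiff_const.clm_comp (contDiff_id.clm_comp contDiff_const)
    exact (h1.restrict_scalars ℝ).comp_contDiffOn h𝒥C
  · intro u v
    rw [ContinuousLinearMap.comp_apply, inner_rieszInverse]
    exact h𝒯 χ hχ (F.toV u) (F.toV v)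
  · intro u v
    rw [ContinuousLinearMap.comp_apply, inner_rieszInverse]
    exact h𝒥 χ hχ (F.toV u) (F.toV v)

/-- The derivative of the real part of a form `⟨u, T χ u⟩` in a direction. -/
theorem hasLineDerivAt_re_inner {E : Type*} [NormedAddCommGroup E] [InnerProductSpace ℂ E]
    {T : X → E →L[ℂ] E} {χ₀ : X} (hT : DifferentiableAt ℝ T χ₀) (u : E) (v : X) :
    HasLineDerivAt ℝ (fun χ => (inner ℂ u (T χ u)).re) (inner ℂ u (fderiv ℝ T χ₀ v u)).re χ₀ v := by
  have hγ : HasDerivAt (fun t : ℝ => χ₀ + t • v) v 0 := by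
    simpa using ((hasDerivAt_id (0 : ℝ)).smul_const v).const_add χ₀
  have h1 : HasDerivAt (fun t : ℝ => T (χ₀ + t • v)) (fderiv ℝ T χ₀ v) 0 :=
    hT.hasFDerivAt.comp_hasDerivAt_of_eq 0 hγ (by simp)
  have h2 := h1.complexClm_apply (hasDerivAt_const 0 u)
  have h3 := (hasDerivAt_const (0 : ℝ) (innerSL ℂ u)).complexClm_apply h2
  have h4 := Complex.reCLM.hasFDerivAt.comp_hasDerivAt (0 : ℝ) h3
  have h5 : HasDerivAt (fun t : ℝ => (inner ℂ u (T (χ₀ + t • v) u)).re)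
      (inner ℂ u (fderiv ℝ T χ₀ v u)).re 0 := by
    simpa [Function.comp_def] using h4
  exact h5

end OperatorFamily

/-! ### Eigenvalues of the operators `A^* A` -/

theorem finiteDimensional_pencilEigenspace_of_lt_pencilEigenvalue {E : Type*}
    [NormedAddCommGroup E] [InnerProductSpace ℂ E] {T J : E →L[ℂ] E} {μ : ℝ} (hμ : 0 < μ) {k : ℕ}
    (hk : μ < pencilEigenvalue T J k) : FiniteDimensional ℂ (pencilEigenspace T J μ) := by
  have hcount : pencilCount T J μ < k := by
    by_contra! hle
    have hbdd : BddBelow {t : ℝ | 0 < t ∧ (k : Cardinal) ≤ pencilCount T J t} :=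
      ⟨0, fun t ht => ht.1.le⟩
    exact (csInf_le hbdd ⟨hμ, hle⟩).not_gt hk
  refine Module.rank_lt_aleph0_iff.1 (lt_of_le_of_lt ?_ (hcount.trans Cardinal.natCast_lt_aleph0))
  exact Submodule.rank_mono (pencilEigenspace_le_pencilSpan ⟨hμ, le_rfl⟩)

theorem mainTheorem1 {X H0 H1 : Type*} [NormedAddCommGroup X] [NormedSpace ℝ X] [CompleteSpace X]
    [NormedAddCommGroup H0] [InnerProductSpace ℂ H0] [CompleteSpace H0]
    [NormedAddCommGroup H1] [InnerProductSpace ℂ H1] [CompleteSpace H1]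
    (F : OperatorFamily X H0 H1) (r : WithTop ℕ∞) (hr : 1 ≤ r) (hF : F.IsOfClass r)
    (χ₀ : X) (hχ₀ : χ₀ ∈ F.params)
    -- `lam` is a positive eigenvalue of multiplicity `m`, with indices `k, …, k + m - 1`
    (lam : ℝ) (hlam : 0 < lam) (k m : ℕ) (hk : 1 ≤ k) (hm : 1 ≤ m)
    (hmult : Module.finrank ℂ (F.eigenspace χ₀ lam) = m)
    (hindex : ∀ j ∈ Finset.Icc k (k + m - 1), F.eigenvalue χ₀ j = lam)
    -- no positive eigenvalue branches off from `0` at `χ₀`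
    (hgap : ∃ ε > 0, ∀ᶠ χ in nhds χ₀, ∀ μ ∈ Set.Ioo 0 ε, F.eigenspace χ μ = ⊥) :
    (∃ U : Set X, IsOpen U ∧ χ₀ ∈ U ∧ U ⊆ F.params ∧
      ∀ s ∈ Finset.Icc 1 m, ContDiffOn ℝ r (F.symmFun (Finset.Icc k (k + m - 1)) s) U) ∧
    ∀ u : Fin m → F.V,
      (∀ h, (u h : H0) ∈ F.eigenspace χ₀ lam) →
      (∀ h l, scp (F.ip0 χ₀) (u h : H0) (u l : H0) = if h = l then 1 else 0) →
      ∀ v : X,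
        (∀ h, LineDifferentiableAt ℝ (F.energy (u h)) χ₀ v ∧
          LineDifferentiableAt ℝ (F.mass (u h)) χ₀ v) ∧
        ∀ s ∈ Finset.Icc 1 m,
          HasLineDerivAt ℝ (F.symmFun (Finset.Icc k (k + m - 1)) s)
            (lam ^ (s - 1) * ((m - 1).choose (s - 1) : ℝ) *
              ∑ h, (lineDeriv ℝ (F.energy (u h)) χ₀ v - lam * lineDeriv ℝ (F.mass (u h)) χ₀ v))
            χ₀ v := by
  have : CompleteSpace F.VSpace :=
    GraphDomain.completeSpace (F.A F.ref) (F.isClosed_A F.ref F.ref_mem)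
  obtain ⟨T, J, hTC, hJC, hrep, hfact⟩ := hF.exists_pencil
  have hparams : ∀ᶠ χ in nhds χ₀, χ ∈ F.params := F.isOpen_params.mem_nhds hχ₀
  have hT : ∀ᶠ χ in nhds χ₀, ContDiffAt ℝ r T χ := hparams.mono fun χ hχ =>
    hTC.contDiffAt (F.isOpen_params.mem_nhds hχ)
  have hJ : ∀ᶠ χ in nhds χ₀, ContDiffAt ℝ r J χ := hparams.mono fun χ hχ =>
    hJC.contDiffAt (F.isOpen_params.mem_nhds hχ)
  have hsymm : ∀ᶠ χ in nhds χ₀, IsSymmetricPencil (T χ) (J χ) := hparams.mono fun χ hχ =>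
    (hrep χ hχ).isSymmetricPencil hχ
  have hrep₀ := hrep χ₀ hχ₀
  have hm' : Module.finrank ℂ (pencilEigenspace (T χ₀) (J χ₀) lam) = m := by
    rw [← hmult, hrep₀.eigenspace_eq_map]
    exact (Submodule.equivMapOfInjective (F.inclusion : F.VSpace →ₗ[ℂ] H0)
      F.inclusion_injective _).finrank_eq
  have hindex' : ∀ j ∈ Finset.Icc k (k + m - 1), pencilEigenvalue (T χ₀) (J χ₀) j = lam :=
    fun j hj => (hrep₀.eigenvalue_eq j).symm.trans (hindex j hj)
  have hunit : ∀ μ ∈ Set.Ioc 0 lam,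
      ∃ _ : FiniteDimensional ℂ (pencilEigenspace (T χ₀) (J χ₀) μ),
        IsUnit (borderedPencil (T χ₀) (J χ₀) μ (pencilEigenspace (T χ₀) (J χ₀) μ)) := by
    rintro μ ⟨hμ, hμlam⟩
    have hfin : FiniteDimensional ℂ (pencilEigenspace (T χ₀) (J χ₀) μ) := by
      -- at `lam` the multiplicity is `m`; below `lam` it is finite, since otherwise the `k`-th
      -- eigenvalue would be smaller than `lam`
      rcases hμlam.eq_or_lt with rfl | hlt
      · exact Module.finite_of_finrank_pos (by omega)
      · refine finiteDimensional_pencilEigenspace_of_lt_pencilEigenvalue hμ (k := k) ?_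
        rwa [hindex' k (Finset.mem_Icc.2 (by omega))]
    obtain ⟨j, J₀, hj⟩ := hfact χ₀
    exact ⟨hfin, hrep₀.isUnit_borderedPencil hχ₀ hj hμ⟩
  obtain ⟨ε, hε, hgap⟩ := hgap
  have hgap' : ∀ᶠ χ in nhds χ₀, ∀ μ ∈ Set.Ioo 0 ε, pencilEigenspace (T χ) (J χ) μ = ⊥ := by
    filter_upwards [hgap, hparams] with χ h hχ μ hμ
    have := h μ hμ
    rw [(hrep χ hχ).eigenspace_eq_map,
      ← Submodule.map_bot (F.inclusion : F.VSpace →ₗ[ℂ] H0)] at this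
    exact Submodule.map_injective_of_injective F.inclusion_injective this
  have key := fun s (hs : s ∈ Finset.Icc 1 m) =>
    contDiffAt_and_hasLineDerivAt_symm_pencilEigenvalue hr hT hJ hsymm hlam hunit hε hgap' hk hm
      hm' hindex' hs
  have hsymmFun : ∀ s, ∀ χ ∈ F.params, F.symmFun (Finset.Icc k (k + m - 1)) s χ =
      ∑ S ∈ (Finset.Icc k (k + m - 1)).powersetCard s,
        ∏ j ∈ S, pencilEigenvalue (T χ) (J χ) j := fun s χ hχ => by
    simp only [OperatorFamily.symmFun, (hrep χ hχ).eigenvalue_eq]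
  constructor
  · have hall : ∀ᶠ χ in nhds χ₀, χ ∈ F.params ∧ ∀ s ∈ Finset.Icc 1 m,
        ContDiffAt ℝ r (F.symmFun (Finset.Icc k (k + m - 1)) s) χ := by
      refine hparams.and ((Filter.eventually_all_finset _).2 fun s hs => ?_)
      filter_upwards [(key s hs).1, hparams] with χ h hχ
      refine h.congr_of_eventuallyEq ?_
      filter_upwards [F.isOpen_params.mem_nhds hχ] with χ' hχ'
      exact hsymmFun s χ' hχ'
    obtain ⟨U, hU, hUo, hχU⟩ := mem_nhds_iff.1 hall
    exact ⟨U, hUo, hχU, fun χ hχ => (hU hχ).1,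
      fun s hs χ hχ => ((hU hχ).2 s hs).contDiffWithinAt⟩
  · intro u hu hortho v
    let w : Fin m → F.VSpace := fun h => (GraphDomain.toDomain (F.A F.ref)).symm (u h)
    have hw : ∀ h, w h ∈ pencilEigenspace (T χ₀) (J χ₀) lam := by
      intro h
      have h1 := hu h
      rw [hrep₀.eigenspace_eq_map] at h1
      obtain ⟨x, hx, hxu⟩ := h1
      have : x = w h := F.inclusion_injective hxu
      rwa [← this]
    have hworth : ∀ h l, inner ℂ (w l) (J χ₀ (w h)) = if h = l then 1 else 0 := fun h l =>
      (hrep₀.inner_right (w h) (w l)).trans (hortho h l)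
    have hr0 : r ≠ 0 := (zero_lt_one.trans_le hr).ne'
    have henergy : ∀ h, HasLineDerivAt ℝ (F.energy (u h))
        (inner ℂ (w h) (fderiv ℝ T χ₀ v (w h))).re χ₀ v := by
      intro h
      refine (OperatorFamily.hasLineDerivAt_re_inner
        (hT.self_of_nhds.differentiableAt hr0) (w h) v).congr_of_eventuallyEq ?_
      filter_upwards [hparams] with χ hχ
      exact congrArg Complex.re ((hrep χ hχ).inner_left (w h) (w h)).symm
    have hmass : ∀ h, HasLineDerivAt ℝ (F.mass (u h))
        (inner ℂ (w h) (fderiv ℝ J χ₀ v (w h))).re χ₀ v := by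
      intro h
      refine (OperatorFamily.hasLineDerivAt_re_inner
        (hJ.self_of_nhds.differentiableAt hr0) (w h) v).congr_of_eventuallyEq ?_
      filter_upwards [hparams] with χ hχ
      exact congrArg Complex.re ((hrep χ hχ).inner_right (w h) (w h)).symm
    refine ⟨fun h => ⟨(henergy h).lineDifferentiableAt, (hmass h).lineDifferentiableAt⟩,
      fun s hs => ?_⟩
    have hsum : ∑ h, (lineDeriv ℝ (F.energy (u h)) χ₀ v - lam * lineDeriv ℝ (F.mass (u h)) χ₀ v) =
        ∑ h, (inner ℂ (w h)
          (fderiv ℝ T χ₀ v (w h) - (lam : ℂ) • fderiv ℝ J χ₀ v (w h))).re := by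
      refine Finset.sum_congr rfl fun h _ => ?_
      rw [(henergy h).lineDeriv, (hmass h).lineDeriv, inner_sub_right, inner_smul_right,
        Complex.sub_re, Complex.re_ofReal_mul]
    rw [hsum]
    refine ((key s hs).2 w hw hworth v).congr_of_eventuallyEq ?_
    filter_upwards [hparams] with χ hχ
    exact hsymmFun s χ hχ
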